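/- For $N\ge 1$ consider the Gaussian ensemble of complex $N\times(N+1)$ matrices $B$ with density proportional to $e^{-N\operatorname{tr}BB^\dagger}$ with respect to Lebesgue measure $\prod_{i,j}d\,\mathrm{Re}\,B_{ij}\,d\,\mathrm{Im}\,B_{ij}$ (the generalized Laguerre ensemble with $\gamma_1N=N$, $\gamma_2N=N+1$), and its one-loop mean $$W_1(x)=\frac1N\Bigl\langle \operatorname{tr}\frac1{x-BB^\dagger}\Bigr\rangle ,\qquad x\in\mathbb C\setminus[0,\infty).$$ Then $W_1$ has a unique expansion $$W_1(x)=\sum_{r=0,\frac12,1,\frac32,\dots}N^{-2r}W_1^{(r)}(x),\qquad W_1^{(r)}(x)=\sum_{n=0}^\infty C_n^{(r)}x^{-1-n-2r},$$ with real coefficients $C_n^{(r)}$ that do not depend on $N$, in the following sense: for each fixed $N\ge1$ the double series, ordered by powers of $1/x$ (the coefficient of $x^{-1-p}$ being the finite sum $\sum_{j=0}^{p}N^{-j}C^{(j/2)}_{p-j}$), is the asymptotic expansion of $W_1(x)$ as $x\to\infty$ in every sector $\{x:\operatorname{dist}(x,[0,\infty))\ge\delta|x|\}$, $\delta>0$.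 Put $C_n^{(r)}=0$ whenever $r<0$ or $n<0$. Then for all $n\in\mathbb Z$ and all $r\in\frac12\mathbb Z$, $$\begin{aligned} &(n+1)\bigl(2C^{(r)}_{n-2r}+C^{(r-1/2)}_{n-2r+1}\bigr)-4(2n-1)\bigl(C^{(r)}_{n-2r-1}+C^{(r-1/2)}_{n-2r}\bigr)\\ &-(n-1)(n-2)(n-3)\bigl(2C^{(r-1)}_{n-2r}+C^{(r-3/2)}_{n-2r+1}\bigr)-(n+1)(n-1)C^{(r-1)}_{n-2r+1}\\ &+(n-1)(n-2)(n-3)^2C^{(r-2)}_{n-2r+1} =2\delta_{r,0}\delta_{n,0}+\delta_{r,1/2}\delta_{n,0}+2\delta_{r,1/2}\delta_{n,1}+2\delta_{r,1}\delta_{n,1}. \end{aligned}$$ -/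

import Mathlib

open scoped Filter
open Asymptotics

noncomputable section

namespace GenLaguerre

/-- The average `(1/Z) ∫ DB DB† e^{-N tr BB†} F(B)` over rectangular complex `N × M` matrices, with
respect to Lebesgue measure `∏ d Re B_{ij} d Im B_{ij}`, where `Z = ∫ DB DB† e^{-N tr BB†}`. -/
def average (N M : ℕ) (F : Matrix (Fin N) (Fin M) ℂ → ℂ) : ℂ :=
  (∫ b : Fin N → Fin M → ℂ,
      (Real.exp (-(N : ℝ) *
        (Matrix.trace (Matrix.of b * (Matrix.of b).conjTranspose)).re) : ℂ) * F (Matrix.of b)) /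
    (∫ b : Fin N → Fin M → ℂ,
      (Real.exp (-(N : ℝ) *
        (Matrix.trace (Matrix.of b * (Matrix.of b).conjTranspose)).re) : ℂ))

/-- The one-loop mean `W₁(x) = N⁻¹ ⟨tr (x - BB†)⁻¹⟩` of the `N × (N+1)` ensemble, normalized so that
its expansion at infinity starts with `1/x`. -/
def W₁ (N : ℕ) (x : ℂ) : ℂ :=
  (N : ℂ)⁻¹ * average N (N + 1) fun B =>
    Matrix.trace ((Matrix.scalar (Fin N) x - B * B.conjTranspose)⁻¹)

/-- The coefficient of `x^{-1-p}` in the double series `∑_j N^{-j} ∑_n C j n x^{-1-n-j}`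
(`j, n ≥ 0`). Here `C j n` stands for `C_n^{(r)}` with `r = j/2`, so that `j = 2r`. -/
def doubleSeriesCoeff (C : ℤ → ℤ → ℝ) (N p : ℕ) : ℝ :=
  ∑ j ∈ Finset.range (p + 1), C j ((p : ℤ) - j) / (N : ℝ) ^ j

/-- A nontangential region around infinity in `ℂ \ [0,∞)`: the closed sector of the points whose
distance to the half-line `[0,∞)` is at least `δ |x|`. -/
def sector (δ : ℝ) : Set ℂ :=
  {x | ∀ t : ℝ, 0 ≤ t → δ * ‖x‖ ≤ ‖x - t‖}

/-- `C j n = C_n^{(j/2)}` are the coefficients of the fractional-genus expansion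
`W₁(x) = ∑_r N^{-2r} W₁^{(r)}(x)`, `W₁^{(r)}(x) = ∑_n C_n^{(r)} x^{-1-n-2r}`, `r = 0, 1/2, 1, …`,
extended by zero to negative indices: for every `N ≥ 1` the double series, ordered by powers of
`1/x`, is the asymptotic expansion of `W₁(x)` as `x → ∞` away from the half-line `[0,∞)`. -/
def IsFractionalGenusExpansion (C : ℤ → ℤ → ℝ) : Prop :=
  (∀ j n : ℤ, j < 0 ∨ n < 0 → C j n = 0) ∧
    ∀ N : ℕ, 1 ≤ N → ∀ δ : ℝ, 0 < δ → ∀ P : ℕ,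
      (fun x : ℂ => W₁ N x -
          ∑ p ∈ Finset.range P, (doubleSeriesCoeff C N p : ℂ) / x ^ (p + 1))
        =O[Bornology.cobounded ℂ ⊓ 𝓟 (sector δ)] fun x : ℂ => 1 / x ^ (P + 1)

end GenLaguerre

end

/-! The coefficient of `x^{-1-p}` in `W₁` is the moment `N⁻¹ ⟨tr (BB†)^p⟩`, so everything rests on a
recurrence for these moments in `p`. With `W = BB†`, the power sum `tr W^{k+1}` is the alternating
sum of the hook Schur functions of size `k + 1` (`sum_hookTrace`). Gaussian integration by parts
turns the mean of a hook into the mean of a divergence, which is a combination of the hooks with one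
box removed (`hookDiv_succ_succ`). Hence each hook has a mean of product form, an arm weight times a
leg weight (`apply_hookTrace`). Summing these weights over hooks of fixed size and eliminating the
auxiliary sum of arm minus leg gives a three-term recurrence (`wishartMoment_recurrence`). After
scaling, the moments are polynomials `r_p` in `X = 1/N` of degree at most `p`, and `C_n^{(j/2)}` is
the coefficient of `X^j` in `r_{n+j}`. The relation claimed is `2 + X` times the three-term
recurrence for `r_n`, minus `(n - 2) X^2` times the one for `r_{n-1}`, read off at `X^j`; the
right-hand side comes from `n = 0, 1`. The expansion itself follows from the geometric series of the
resolvent, with a remainder controlled by the distance to the spectrum. Uniqueness holds first for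
each `N`, and then for the coefficients because a polynomial is determined by its values at all
`1/N`. -/

namespace GenLaguerre

open Matrix Finset

/-! ### Power series of `det (1 - x W)^{-θ}` and of its product with the resolvent, coefficient by
coefficient. -/

section TraceRecursion

variable {A : Type*} [CommRing A] [Algebra ℂ A] {n : Type*} [Fintype n] [DecidableEq n]

/-- The matrices `P_l = ∑ h_{l-i} W^i`, where `∑ h_l x^l = det (1 - x W)^{-θ}`, generated by
`P_{l+1} = θ (l+1)⁻¹ tr (W P_l) + W P_l`. -/
noncomputable def resolventCoeff (θ : ℂ) (W : Matrix n n A) : ℕ → Matrix n n A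
  | 0 => 1
  | l + 1 => ((θ / ((l : ℂ) + 1)) • trace (W * resolventCoeff θ W l)) • 1
      + W * resolventCoeff θ W l

/-- The coefficients of `det (1 - x W)^{-θ}`. -/
noncomputable def detPowCoeff (θ : ℂ) (W : Matrix n n A) : ℕ → A
  | 0 => 1
  | l + 1 => (θ / ((l : ℂ) + 1)) • trace (W * resolventCoeff θ W l)

variable (θ : ℂ) (W : Matrix n n A)

theorem resolventCoeff_zero : resolventCoeff θ W 0 = 1 := rfl

theorem detPowCoeff_zero : detPowCoeff θ W 0 = 1 := rfl

theorem resolventCoeff_succ (l : ℕ) : resolventCoeff θ W (l + 1) =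
    detPowCoeff θ W (l + 1) • 1 + W * resolventCoeff θ W l := rfl

theorem commute_resolventCoeff (l : ℕ) : Commute W (resolventCoeff θ W l) := by
  induction l with
  | zero => exact Commute.one_right W
  | succ l ih =>
    rw [resolventCoeff_succ]
    exact ((Commute.one_right W).smul_right _).add_right ((Commute.refl W).mul_right ih)

theorem commute_resolventCoeff_of_commute {V : Matrix n n A} (h : Commute V W) (l : ℕ) :
    Commute V (resolventCoeff θ W l) := by
  induction l with
  | zero => exact Commute.one_right V
  | succ l ih =>
    rw [resolventCoeff_succ]
    exact ((Commute.one_right V).smul_right _).add_right (h.mul_right ih)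

theorem natCast_smul_detPowCoeff_succ (l : ℕ) :
    ((l : ℂ) + 1) • detPowCoeff θ W (l + 1) = θ • trace (W * resolventCoeff θ W l) := by
  have h : (l : ℂ) + 1 ≠ 0 := Nat.cast_add_one_ne_zero l
  rw [detPowCoeff, smul_smul]
  congr 1
  field_simp

theorem resolventCoeff_eq_sum (l : ℕ) : resolventCoeff θ W l =
    ∑ ij ∈ antidiagonal l, detPowCoeff θ W ij.1 • W ^ ij.2 := by
  induction l with
  | zero => simp [resolventCoeff_zero, detPowCoeff_zero]
  | succ l ih =>
    rw [resolventCoeff_succ, ih, Finset.Nat.sum_antidiagonal_succ', mul_sum, pow_zero]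
    congr 1
    exact sum_congr rfl fun ij _ => by rw [pow_succ', mul_smul_comm]

theorem trace_mul_resolventCoeff_eq_sum (l : ℕ) : trace (W * resolventCoeff θ W l) =
    ∑ ij ∈ antidiagonal l, detPowCoeff θ W ij.1 * trace (W ^ (ij.2 + 1)) := by
  rw [resolventCoeff_eq_sum, mul_sum, trace_sum]
  exact sum_congr rfl fun ij _ => by rw [mul_smul_comm, trace_smul, pow_succ', smul_eq_mul]

/-- Coefficient form of `F' = F (W R + θ tr (W R))`, where `R = (1 - x W)⁻¹` and `F = det (1 - x
W)^{-θ} R`. -/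
theorem natCast_smul_resolventCoeff_succ (l : ℕ) :
    ((l : ℂ) + 1) • resolventCoeff θ W (l + 1) = ∑ ij ∈ antidiagonal l,
      resolventCoeff θ W ij.1 * (W ^ (ij.2 + 1) + (θ • trace (W ^ (ij.2 + 1))) • 1) := by
  have key : ∀ l : ℕ, W * resolventCoeff θ W l
      + (θ • trace (W * resolventCoeff θ W l)) • (1 : Matrix n n A) =
      ∑ ij ∈ antidiagonal l, detPowCoeff θ W ij.1 •
        (W ^ (ij.2 + 1) + (θ • trace (W ^ (ij.2 + 1))) • 1) := by
    intro l
    rw [trace_mul_resolventCoeff_eq_sum, resolventCoeff_eq_sum, mul_sum, smul_sum, sum_smul,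
      ← sum_add_distrib]
    refine sum_congr rfl fun ij _ => ?_
    rw [mul_smul_comm, pow_succ', smul_add, smul_smul, mul_smul_comm]
  induction l with
  | zero =>
    have := key 0
    simp [resolventCoeff_zero, resolventCoeff_succ, detPowCoeff] at this ⊢
    rw [add_comm]
  | succ l ih =>
    have h1 : ((↑(l + 1) : ℂ) + 1) • resolventCoeff θ W (l + 1 + 1) =
        (W * resolventCoeff θ W (l + 1) + (θ • trace (W * resolventCoeff θ W (l + 1))) • 1)
        + W * (((l : ℂ) + 1) • resolventCoeff θ W (l + 1)) := by
      rw [← natCast_smul_detPowCoeff_succ, resolventCoeff_succ, smul_add, mul_smul_comm,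
        smul_assoc, add_smul _ 1 (W * _), one_smul]
      push_cast
      abel
    rw [h1, key, ih, Finset.Nat.sum_antidiagonal_succ, Finset.Nat.sum_antidiagonal_succ,
      mul_sum, add_assoc, ← sum_add_distrib, detPowCoeff_zero, resolventCoeff_zero, one_smul,
      one_mul]
    congr 1
    refine sum_congr rfl fun ij _ => ?_
    rw [resolventCoeff_succ, add_mul, smul_mul_assoc, one_mul, mul_assoc]

theorem map_derivation_mul (D : Derivation ℂ A A) {l m k : Type*} [Fintype m]
    (X : Matrix l m A) (Y : Matrix m k A) :
    (X * Y).map D = X.map D * Y + X * Y.map D := by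
  ext i j
  simp only [map_apply, mul_apply, Matrix.add_apply, map_sum, Derivation.leibniz, smul_eq_mul,
    sum_add_distrib]
  rw [add_comm]
  congr 1
  exact sum_congr rfl fun _ _ => mul_comm _ _

theorem map_derivation_smul_one {k : Type*} [DecidableEq k] (D : Derivation ℂ A A) (a : A) :
    (a • (1 : Matrix k k A)).map D = D a • 1 := by
  ext i j
  by_cases h : i = j <;> simp [h, one_apply]

theorem map_derivation_resolventCoeff_succ (D : Derivation ℂ A A) (l : ℕ) :
    (resolventCoeff θ W (l + 1)).map D = ∑ ij ∈ antidiagonal l,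
      (D (detPowCoeff θ W (ij.1 + 1)) • W ^ ij.2
        + W ^ ij.2 * (W.map D * resolventCoeff θ W ij.1)) := by
  have h1 : ∀ l, (resolventCoeff θ W (l + 1)).map D = D (detPowCoeff θ W (l + 1)) • 1
      + W.map D * resolventCoeff θ W l + W * (resolventCoeff θ W l).map D := by
    intro l
    rw [resolventCoeff_succ, Matrix.map_add _ (map_add D), map_derivation_smul_one,
      map_derivation_mul, add_assoc]
  induction l with
  | zero =>
    rw [h1]
    have : (resolventCoeff θ W 0).map D = 0 := by
      have := map_derivation_smul_one (k := n) D 1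
      simpa [resolventCoeff_zero] using this
    simp [this]
  | succ l ih =>
    rw [h1, ih, Finset.Nat.sum_antidiagonal_succ', mul_sum, pow_zero, one_mul]
    congr 1
    exact sum_congr rfl fun ij _ => by rw [mul_add, pow_succ', mul_smul_comm, mul_assoc]

/-- Jacobi's formula for the logarithmic derivative of the determinant, in a form needing neither
inverses nor convergence. -/
theorem derivation_detPowCoeff_succ (D : Derivation ℂ A A) (l : ℕ) :
    D (detPowCoeff θ W (l + 1)) = θ • trace (resolventCoeff θ W l * W.map D) := by
  induction l using Nat.strong_induction_on with
  | _ l ih =>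
    have hl : (l : ℂ) + 1 ≠ 0 := Nat.cast_add_one_ne_zero l
    have htr : ∀ V : Matrix n n A, D (trace V) = trace (V.map D) := by
      intro V; simp [trace, map_sum]
    suffices h : trace ((W * resolventCoeff θ W l).map D)
        = ((l : ℂ) + 1) • trace (resolventCoeff θ W l * W.map D) by
      rw [detPowCoeff, Derivation.map_smul, htr, h, smul_smul]
      congr 1
      field_simp
    rw [map_derivation_mul, trace_add]
    cases l with
    | zero =>
      have : (resolventCoeff θ W 0).map D = 0 := by
        have := map_derivation_smul_one (k := n) D 1
        simpa [resolventCoeff_zero] using this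
      rw [this]
      simp [resolventCoeff_zero]
    | succ k =>
      push_cast
      rw [add_smul _ (1 : ℂ), one_smul, trace_mul_comm (W.map D), add_comm]
      congr 1
      rw [← trace_smul, ← smul_mul_assoc, natCast_smul_resolventCoeff_succ,
        map_derivation_resolventCoeff_succ, mul_sum, sum_mul, trace_sum, trace_sum]
      -- Both sides are now sums over the same pairs. The induction hypothesis replaces the
      -- derivative of each lower coefficient by a trace, and the terms agree by cyclicity.
      refine sum_congr rfl fun ij hij => ?_
      have hlt : ij.1 < k + 1 := by
        have := mem_antidiagonal.1 hij; omega
      rw [ih _ hlt, mul_add, mul_add, add_mul, trace_add, trace_add, mul_smul_comm, ← pow_succ',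
        trace_smul, ← mul_assoc, ← mul_assoc, ← pow_succ', mul_smul_comm, mul_one, smul_mul_assoc,
        trace_smul, add_comm]
      congr 1
      · rw [trace_mul_comm, ← mul_assoc]
      · simp only [smul_eq_mul, smul_mul_assoc]; rw [mul_comm]

end TraceRecursion

end GenLaguerre

namespace GenLaguerre

open Matrix Finset

/-! ### Divergences of `c P_k Q_l`, where `D j i` acts as the derivative in the entry `c j i` and
`b` is constant. -/

section Divergence

variable {A : Type*} [CommRing A] [Algebra ℂ A]
  {n m : Type*} [Fintype n]

/-- The partially contracted divergence `(k, j) ↦ ∑ i, D_{ji} G_{ki}` of a matrix `G`. -/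
def matrixDiv (D : m → n → Derivation ℂ A A) (G : Matrix m n A) : Matrix m m A :=
  of fun k j => ∑ i, D j i (G k i)

/-- The gradient `(i, j) ↦ D_{ji} f`. -/
def matrixGrad (D : m → n → Derivation ℂ A A) (f : A) : Matrix n m A :=
  of fun i j => D j i f

variable (D : m → n → Derivation ℂ A A) (b : Matrix n m A) (c : Matrix m n A)

theorem matrixDiv_add (G H : Matrix m n A) :
    matrixDiv D (G + H) = matrixDiv D G + matrixDiv D H := by
  ext k j
  simp [matrixDiv, sum_add_distrib]

theorem matrixDiv_sub (G H : Matrix m n A) :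
    matrixDiv D (G - H) = matrixDiv D G - matrixDiv D H := by
  ext k j
  simp [matrixDiv]

theorem matrixDiv_smul (f : A) (G : Matrix m n A) :
    matrixDiv D (f • G) = f • matrixDiv D G + G * matrixGrad D f := by
  ext k j
  simp [matrixDiv, matrixGrad, mul_apply, sum_add_distrib, mul_sum]

variable [DecidableEq n] [DecidableEq m]

/-- The coefficients of `det (1 - x W)^{-θ} (1 - x c b)⁻¹` for `W = b c`. -/
noncomputable def companionCoeff [Fintype m] (θ : ℂ) : ℕ → Matrix m m A
  | 0 => 1
  | l + 1 => detPowCoeff θ (b * c) (l + 1) • 1 + c * (resolventCoeff θ (b * c) l * b)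

variable {D b c}

theorem matrixDiv_self (hc : ∀ j i j' i', D j i (c j' i') = if j' = j ∧ i' = i then 1 else 0) :
    matrixDiv D c = (Fintype.card n : ℂ) • (1 : Matrix m m A) := by
  ext k j
  by_cases h : k = j <;> simp [matrixDiv, hc, h, one_apply, Nat.cast_smul_eq_nsmul]

variable [Fintype m]

theorem matrixDiv_mul (hb : ∀ j i i' j', D j i (b i' j') = 0)
    (hc : ∀ j i j' i', D j i (c j' i') = if j' = j ∧ i' = i then 1 else 0)
    (G : Matrix m n A) :
    matrixDiv D (c * b * G) = trace (b * G) • 1 + c * b * matrixDiv D G := by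
  have h1 : ∀ j i k l, D j i ((c * b) k l) = if k = j then b i l else 0 := by
    intro j i k l
    rw [mul_apply, map_sum]
    simp only [Derivation.leibniz, hb, hc, smul_eq_mul, mul_zero, zero_add]
    by_cases h : k = j <;> simp [h]
  ext k j
  simp only [matrixDiv, of_apply, Matrix.add_apply, Matrix.smul_apply, mul_apply (M := c * b),
    map_sum, Derivation.leibniz, h1, smul_eq_mul, sum_add_distrib, mul_sum]
  rw [add_comm]
  congr 1
  · by_cases h : k = j
    · subst h
      simp only [if_true, one_apply_eq, mul_one, trace, diag_apply, mul_apply]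
      exact sum_congr rfl fun i _ => sum_congr rfl fun l _ => mul_comm (G l i) (b i l)
    · simp [h]
  · rw [sum_comm]

theorem matrixGrad_detPowCoeff_succ (hb : ∀ j i i' j', D j i (b i' j') = 0)
    (hc : ∀ j i j' i', D j i (c j' i') = if j' = j ∧ i' = i then 1 else 0) (θ : ℂ) (l : ℕ) :
    matrixGrad D (detPowCoeff θ (b * c) (l + 1)) = θ • (resolventCoeff θ (b * c) l * b) := by
  ext i j
  have h : (b * c).map (D j i) = of fun u v => if v = i then b u j else 0 := by
    ext u v
    rw [map_apply, mul_apply, map_sum]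
    simp only [Derivation.leibniz, hb, hc, smul_eq_mul, mul_zero, add_zero, of_apply]
    by_cases h : v = i <;> simp [h]
  rw [matrixGrad, of_apply, derivation_detPowCoeff_succ, h, Matrix.smul_apply]
  congr 1
  simp only [trace, diag_apply, mul_apply, of_apply]
  rw [sum_eq_single i]
  · simp
  · intro k _ hk
    simp [hk]
  · simp

theorem trace_companionCoeff (θ : ℂ) (hθ : θ * θ = 1) (l : ℕ) :
    trace (companionCoeff b c θ l) =
      ((Fintype.card m : ℂ) + θ * l) • detPowCoeff θ (b * c) l := by
  cases l with
  | zero => simp [companionCoeff, detPowCoeff_zero, Nat.cast_smul_eq_nsmul]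
  | succ l =>
    have h := congrArg (θ • ·) (natCast_smul_detPowCoeff_succ θ (b * c) l)
    simp only [smul_smul, hθ, one_smul] at h
    rw [companionCoeff, trace_add, trace_mul_comm c, Matrix.mul_assoc,
      ← (commute_resolventCoeff θ (b * c) l).eq, ← h, trace_smul, trace_one, smul_eq_mul, mul_comm,
      add_smul, Nat.cast_smul_eq_nsmul, nsmul_eq_mul]
    push_cast
    rfl

/-- Induction through `c P_{l+1} = h_{l+1} c + (c b)(c P_l)`. The new contributions are the gradient
of `h_{l+1}` and `tr (W P_l)`. Newton's identity makes the latter `θ (l + 1) h_{l+1}` because `θ² =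
1`, so both fit the same companion coefficient. -/
theorem matrixDiv_mul_resolventCoeff (hb : ∀ j i i' j', D j i (b i' j') = 0)
    (hc : ∀ j i j' i', D j i (c j' i') = if j' = j ∧ i' = i then 1 else 0)
    (θ : ℂ) (hθ : θ * θ = 1) (l : ℕ) :
    matrixDiv D (c * resolventCoeff θ (b * c) l) =
      ((Fintype.card n : ℂ) + θ * l) • companionCoeff b c θ l := by
  induction l with
  | zero => simp [resolventCoeff_zero, companionCoeff, matrixDiv_self hc]
  | succ l ih =>
    have h := congrArg (θ • ·) (natCast_smul_detPowCoeff_succ θ (b * c) l)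
    simp only [smul_smul, hθ, one_smul, Algebra.smul_def (θ * _)] at h
    have h2 : c * b * companionCoeff b c θ l = c * (resolventCoeff θ (b * c) l * b) := by
      cases l with
      | zero => simp [companionCoeff, resolventCoeff_zero]
      | succ l =>
        rw [companionCoeff, resolventCoeff_succ]
        simp only [Matrix.mul_add, Matrix.add_mul, Matrix.mul_smul, Matrix.smul_mul, Matrix.mul_one,
          Matrix.one_mul, Matrix.mul_assoc]
    have h3 : c * resolventCoeff θ (b * c) (l + 1) = detPowCoeff θ (b * c) (l + 1) • c
        + c * b * (c * resolventCoeff θ (b * c) l) := by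
      rw [resolventCoeff_succ, Matrix.mul_add, Matrix.mul_smul, Matrix.mul_one]
      simp only [Matrix.mul_assoc]
    rw [h3, matrixDiv_add, matrixDiv_smul, matrixDiv_self hc, matrixDiv_mul hb hc, ih,
      matrixGrad_detPowCoeff_succ hb hc, Matrix.mul_smul, Matrix.mul_smul, h2, companionCoeff,
      ← Matrix.mul_assoc b, ← h]
    push_cast
    module

/-! ### Hook Schur functions and their divergences. -/

/-- The hook functions `(a + b + 1)⁻¹ tr (W P_a Q_b)`, where `P` and `Q` are the coefficients of
`det (1 - x W)^{∓1} (1 - x W)⁻¹`. Up to sign these are the hook Schur functions of `W`. -/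
noncomputable def hookTrace (W : Matrix n n A) (a b : ℕ) : A :=
  (((a : ℂ) + b + 1)⁻¹) • trace (W * (resolventCoeff 1 W a * resolventCoeff (-1) W b))

theorem natCast_smul_hookTrace (W : Matrix n n A) (k l : ℕ) :
    ((k : ℂ) + l + 1) • hookTrace W k l =
      trace (W * (resolventCoeff 1 W k * resolventCoeff (-1) W l)) := by
  have h : (k : ℂ) + l + 1 ≠ 0 := by exact_mod_cast Nat.succ_ne_zero (k + l)
  rw [hookTrace, smul_smul, mul_inv_cancel₀ h, one_smul]

theorem resolventCoeff_mul_sub (W : Matrix n n A) (k l : ℕ) :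
    resolventCoeff 1 W (k + 1) * resolventCoeff (-1) W l
      - resolventCoeff 1 W k * resolventCoeff (-1) W (l + 1) =
    detPowCoeff 1 W (k + 1) • resolventCoeff (-1) W l
      - detPowCoeff (-1) W (l + 1) • resolventCoeff 1 W k := by
  have h := (commute_resolventCoeff_of_commute 1 W (Commute.refl W) k).eq
  rw [resolventCoeff_succ, resolventCoeff_succ, add_mul, mul_add, smul_mul_assoc, one_mul,
    mul_smul_comm, mul_one, h, mul_assoc]
  abel

theorem hookTrace_zero_right (W : Matrix n n A) (k : ℕ) :
    hookTrace W k 0 = detPowCoeff 1 W (k + 1) := by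
  simp [hookTrace, detPowCoeff, resolventCoeff_zero]

theorem hookTrace_zero_left (W : Matrix n n A) (l : ℕ) :
    hookTrace W 0 l = - detPowCoeff (-1) W (l + 1) := by
  simp [hookTrace, detPowCoeff, resolventCoeff_zero, neg_div]

/-- Pieri's rule: complete times elementary symmetric function is a sum of two hooks. It is the
trace of `W` times `resolventCoeff_mul_sub`, evaluated by Newton's identities. -/
theorem detPowCoeff_mul_detPowCoeff (W : Matrix n n A) (k l : ℕ) :
    detPowCoeff 1 W (k + 1) * detPowCoeff (-1) W (l + 1) =
      hookTrace W k (l + 1) - hookTrace W (k + 1) l := by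
  have h : (k : ℂ) + l + 2 ≠ 0 := by exact_mod_cast Nat.succ_ne_zero (k + l + 1)
  have h1 := natCast_smul_detPowCoeff_succ 1 W k
  have h2 := natCast_smul_detPowCoeff_succ (-1) W l
  have h3 := natCast_smul_hookTrace W k (l + 1)
  have h4 := natCast_smul_hookTrace W (k + 1) l
  have h5 := congrArg (fun X => trace (W * X)) (resolventCoeff_mul_sub W k l)
  simp only [mul_sub, trace_sub, mul_smul_comm, trace_smul, smul_eq_mul, ← h3, ← h4] at h5
  rw [one_smul] at h1
  rw [neg_smul, one_smul] at h2
  rw [← h1, ← neg_eq_iff_eq_neg.2 h2] at h5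
  simp only [Algebra.smul_def] at h5
  push_cast at h5
  have h6 : ((k : ℂ) + l + 2) • (detPowCoeff 1 W (k + 1) * detPowCoeff (-1) W (l + 1)) =
      ((k : ℂ) + l + 2) • (hookTrace W k (l + 1) - hookTrace W (k + 1) l) := by
    simp only [Algebra.smul_def]
    simp only [map_add, map_natCast, map_ofNat] at h5 ⊢
    linear_combination h5
  have h7 := congrArg (fun X => ((k : ℂ) + l + 2)⁻¹ • X) h6
  simpa only [smul_smul, inv_mul_cancel₀ h, one_smul] using h7

theorem sum_detPowCoeff_mul_detPowCoeff (W : Matrix n n A) (k : ℕ) :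
    ∑ ij ∈ antidiagonal (k + 1), detPowCoeff 1 W ij.1 * detPowCoeff (-1) W ij.2 = 0 := by
  cases k with
  | zero =>
    simp [Finset.Nat.sum_antidiagonal_succ, detPowCoeff, resolventCoeff_zero]
  | succ k =>
    have h1 := Finset.Nat.sum_antidiagonal_succ (n := k) (f := fun ij => hookTrace W ij.1 ij.2)
    have h2 := Finset.Nat.sum_antidiagonal_succ' (n := k) (f := fun ij => hookTrace W ij.1 ij.2)
    rw [Finset.Nat.sum_antidiagonal_succ, Finset.Nat.sum_antidiagonal_succ']
    simp only [detPowCoeff_mul_detPowCoeff, sum_sub_distrib, detPowCoeff_zero, mul_one, one_mul]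
    rw [← hookTrace_zero_right, ← neg_neg (detPowCoeff (-1) W _), ← hookTrace_zero_left]
    simp only at h1 h2
    linear_combination h1 - h2

/-- The two determinants cancel, leaving the coefficients of `(1 - x W)⁻²`. -/
theorem sum_resolventCoeff_mul_resolventCoeff (W : Matrix n n A) (k : ℕ) :
    ∑ ij ∈ antidiagonal k, resolventCoeff 1 W ij.1 * resolventCoeff (-1) W ij.2 =
      ((k : ℂ) + 1) • W ^ k := by
  have h1 : ∀ k, ∑ ij ∈ antidiagonal k, detPowCoeff 1 W ij.1 • resolventCoeff (-1) W ij.2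
      = W ^ k := by
    intro k
    induction k with
    | zero => simp [detPowCoeff_zero, resolventCoeff_zero]
    | succ k ih =>
      have h0 := sum_detPowCoeff_mul_detPowCoeff W k
      rw [Finset.Nat.sum_antidiagonal_succ'] at h0 ⊢
      simp only [resolventCoeff_succ, resolventCoeff_zero, smul_add, sum_add_distrib, smul_smul,
        ← sum_smul, ← mul_smul_comm, ← mul_sum, ih, detPowCoeff_zero, mul_one] at h0 ⊢
      rw [← add_assoc, ← add_smul, h0, zero_smul, zero_add, pow_succ']
  induction k with
  | zero => simp [resolventCoeff_zero]
  | succ k ih =>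
    have h2 := h1 (k + 1)
    rw [Finset.Nat.sum_antidiagonal_succ] at h2 ⊢
    simp only [detPowCoeff_zero, one_smul] at h2
    simp only [resolventCoeff_succ 1, add_mul, smul_mul_assoc, one_mul, sum_add_distrib, mul_assoc,
      ← mul_sum, ih, resolventCoeff_zero]
    rw [← add_assoc, h2, mul_smul_comm, ← pow_succ']
    push_cast
    module

theorem sum_hookTrace (W : Matrix n n A) (k : ℕ) :
    ∑ ij ∈ antidiagonal k, hookTrace W ij.1 ij.2 = trace (W ^ (k + 1)) := by
  have h : (k : ℂ) + 1 ≠ 0 := Nat.cast_add_one_ne_zero k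
  have h1 := congrArg (fun X => ((k : ℂ) + 1)⁻¹ • trace (W * X))
    (sum_resolventCoeff_mul_resolventCoeff W k)
  simp only [mul_smul_comm, trace_smul, smul_smul, inv_mul_cancel₀ h, one_smul, ← pow_succ',
    mul_sum, trace_sum, smul_sum] at h1
  rw [← h1]
  refine sum_congr rfl fun ij hij => ?_
  rw [hookTrace, ← mem_antidiagonal.1 hij]
  push_cast
  rfl

/-- The divergence of `c P_k Q_l`. -/
noncomputable def hookDiv (D : m → n → Derivation ℂ A A) (b : Matrix n m A) (c : Matrix m n A)
    (k l : ℕ) : A :=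
  trace (matrixDiv D (c * (resolventCoeff 1 (b * c) k * resolventCoeff (-1) (b * c) l)))

theorem hookDiv_zero_right (hb : ∀ j i i' j', D j i (b i' j') = 0)
    (hc : ∀ j i j' i', D j i (c j' i') = if j' = j ∧ i' = i then 1 else 0) (k : ℕ) :
    hookDiv D b c k 0 = (((Fintype.card n : ℂ) + k) * ((Fintype.card m : ℂ) + k)) •
      detPowCoeff 1 (b * c) k := by
  rw [hookDiv, resolventCoeff_zero, mul_one, matrixDiv_mul_resolventCoeff hb hc 1 (by norm_num),
    trace_smul, trace_companionCoeff 1 (by norm_num), smul_smul, one_mul]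

theorem hookDiv_zero_left (hb : ∀ j i i' j', D j i (b i' j') = 0)
    (hc : ∀ j i j' i', D j i (c j' i') = if j' = j ∧ i' = i then 1 else 0) (l : ℕ) :
    hookDiv D b c 0 l = (((Fintype.card n : ℂ) - l) * ((Fintype.card m : ℂ) - l)) •
      detPowCoeff (-1) (b * c) l := by
  rw [hookDiv, resolventCoeff_zero, one_mul, matrixDiv_mul_resolventCoeff hb hc (-1) (by norm_num),
    trace_smul, trace_companionCoeff (-1) (by norm_num), smul_smul, neg_one_mul, ← sub_eq_add_neg,
    ← sub_eq_add_neg]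

/-- The difference `P_{k+1} Q_l - P_k Q_{l+1}` involves only scalar multiples of a single `P` or
`Q`, whose divergences are known. The gradients of the two scalars each contribute `tr (W P_k Q_l)`,
whence the factor 2. -/
theorem hookDiv_succ_sub (hb : ∀ j i i' j', D j i (b i' j') = 0)
    (hc : ∀ j i j' i', D j i (c j' i') = if j' = j ∧ i' = i then 1 else 0) (k l : ℕ) :
    hookDiv D b c (k + 1) l - hookDiv D b c k (l + 1) =
      (((Fintype.card n : ℂ) - l) * ((Fintype.card m : ℂ) - l)) •
        (detPowCoeff 1 (b * c) (k + 1) * detPowCoeff (-1) (b * c) l)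
      - (((Fintype.card n : ℂ) + k) * ((Fintype.card m : ℂ) + k)) •
        (detPowCoeff 1 (b * c) k * detPowCoeff (-1) (b * c) (l + 1))
      + (2 * ((k : ℂ) + l + 1)) • hookTrace (b * c) k l := by
  have h1 := hookDiv_zero_right hb hc k
  have h2 := hookDiv_zero_left hb hc l
  rw [hookDiv, resolventCoeff_zero, mul_one] at h1
  rw [hookDiv, resolventCoeff_zero, one_mul] at h2
  have h3 : ∀ X Y : Matrix n n A, Commute (b * c) (X * Y) →
      trace (c * X * (Y * b)) = trace (b * c * (X * Y)) := by
    intro X Y h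
    rw [Matrix.mul_assoc, trace_mul_comm, ← Matrix.mul_assoc, Matrix.mul_assoc _ b, ← h.eq]
  have hP := commute_resolventCoeff 1 (b * c) k
  have hQ := commute_resolventCoeff (-1) (b * c) l
  have hPQ := commute_resolventCoeff_of_commute (-1) (b * c) hP.symm l
  rw [hookDiv, hookDiv, ← trace_sub, ← matrixDiv_sub, ← Matrix.mul_sub, resolventCoeff_mul_sub,
    Matrix.mul_sub, Matrix.mul_smul, Matrix.mul_smul, matrixDiv_sub, matrixDiv_smul, matrixDiv_smul,
    matrixGrad_detPowCoeff_succ hb hc, matrixGrad_detPowCoeff_succ hb hc]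
  simp only [trace_sub, trace_add, trace_smul, h1, h2, one_smul, neg_smul,
    trace_neg, Matrix.mul_neg]
  rw [h3 _ _ (hQ.mul_right hP), h3 _ _ (hP.mul_right hQ), ← hPQ.eq, ← natCast_smul_hookTrace]
  simp only [smul_eq_mul, Algebra.smul_def, map_mul, map_ofNat]
  ring

/-- Induction on the leg: `hookDiv_succ_sub` trades a leg box for an arm box until the leg index is
zero, and Pieri's rule turns the products into hooks. The two terms remove the last box of the arm
or of the leg, weighted by `(n + content)(m + content)` of that box. -/
theorem hookDiv_succ_succ (hb : ∀ j i i' j', D j i (b i' j') = 0)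
    (hc : ∀ j i j' i', D j i (c j' i') = if j' = j ∧ i' = i then 1 else 0) (k l : ℕ) :
    hookDiv D b c (k + 1) (l + 1) =
      (((Fintype.card n : ℂ) + (k + 1)) * ((Fintype.card m : ℂ) + (k + 1))) •
        hookTrace (b * c) k (l + 1)
      - (((Fintype.card n : ℂ) - (l + 1)) * ((Fintype.card m : ℂ) - (l + 1))) •
        hookTrace (b * c) (k + 1) l := by
  induction l generalizing k with
  | zero =>
    have h := hookDiv_succ_sub hb hc (k + 1) 0
    rw [hookDiv_zero_right hb hc, detPowCoeff_mul_detPowCoeff, detPowCoeff_zero, mul_one,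
      ← hookTrace_zero_right] at h
    simp only [Algebra.smul_def] at h ⊢
    push_cast at h ⊢
    simp only [map_ofNat] at h
    linear_combination -h
  | succ l ih =>
    have h := hookDiv_succ_sub hb hc (k + 1) (l + 1)
    rw [ih, detPowCoeff_mul_detPowCoeff, detPowCoeff_mul_detPowCoeff] at h
    simp only [Algebra.smul_def] at h ⊢
    push_cast at h ⊢
    simp only [map_ofNat] at h
    linear_combination -h

end Divergence

end GenLaguerre

/-! ### Means of hooks under a functional that satisfies integration by parts. -/

namespace GenLaguerre

open Matrix Finset

/-- `u_k = ∏_{i ≤ k} (z + i) (w + i) / k!`. -/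
noncomputable def armWeight (z w : ℂ) : ℕ → ℂ
  | 0 => z * w
  | k + 1 => (z + (k + 1)) * (w + (k + 1)) / (k + 1) * armWeight z w k

/-- `v_l = ∏_{i < l} (-(z - i - 1) (w - i - 1) / (i + 1))`. -/
noncomputable def legWeight (z w : ℂ) : ℕ → ℂ
  | 0 => 1
  | l + 1 => -((z - (l + 1)) * (w - (l + 1)) / (l + 1)) * legWeight z w l

theorem succ_mul_armWeight (z w : ℂ) (k : ℕ) :
    ((k : ℂ) + 1) * armWeight z w (k + 1) = (z + (k + 1)) * (w + (k + 1)) * armWeight z w k := by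
  have h : (k : ℂ) + 1 ≠ 0 := Nat.cast_add_one_ne_zero k
  rw [armWeight]; field_simp

theorem succ_mul_legWeight (z w : ℂ) (l : ℕ) :
    ((l : ℂ) + 1) * legWeight z w (l + 1) =
      -((z - (l + 1)) * (w - (l + 1))) * legWeight z w l := by
  have h : (l : ℂ) + 1 ≠ 0 := Nat.cast_add_one_ne_zero l
  rw [legWeight]; field_simp

section Expectation

variable {A : Type*} [CommRing A] [Algebra ℂ A] {n m : Type*} [Fintype n] [DecidableEq n]
  [Fintype m] [DecidableEq m] {D : m → n → Derivation ℂ A A} {b : Matrix n m A} {c : Matrix m n A}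
  {E : A →ₗ[ℂ] ℂ} {τ : ℂ}

/-- This is the content product of the hook over its hook lengths `(k + l + 1) k! l!`, up to the
sign of the leg. The induction removes one box at a time; the two removals recombine through `(k +
1) + (l + 1) = k + l + 2`. -/
theorem apply_hookTrace (hb : ∀ j i i' j', D j i (b i' j') = 0)
    (hc : ∀ j i j' i', D j i (c j' i') = if j' = j ∧ i' = i then 1 else 0)
    (hE : ∀ i j f, E (b i j * f) = τ * E (D j i f)) (hE1 : E 1 = 1) (k l : ℕ) :
    ((k : ℂ) + l + 1) * E (hookTrace (b * c) k l) =
      τ ^ (k + l + 1) * (armWeight (Fintype.card n) (Fintype.card m) k *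
        legWeight (Fintype.card n) (Fintype.card m) l) := by
  have h1 : ∀ k l : ℕ, ((k : ℂ) + l + 1) * E (hookTrace (b * c) k l) = τ * E (hookDiv D b c k l) := by
    intro k l
    have h := congrArg E (natCast_smul_hookTrace (b * c) k l)
    rw [map_smul, smul_eq_mul] at h
    rw [h, hookDiv, Matrix.mul_assoc]
    generalize c * (resolventCoeff 1 (b * c) k * resolventCoeff (-1) (b * c) l) = G
    simp only [trace, diag_apply, mul_apply, map_sum, hE, matrixDiv, of_apply, mul_sum]
    exact sum_comm
  set z : ℂ := (Fintype.card n : ℂ)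
  set w : ℂ := (Fintype.card m : ℂ)
  induction k generalizing l with
  | zero =>
    induction l with
    | zero =>
      rw [h1, hookDiv_zero_left hb hc, detPowCoeff_zero, map_smul, hE1, armWeight, legWeight]
      simp [z, w]
    | succ l ih =>
      have h2 : (l : ℂ) + 1 ≠ 0 := Nat.cast_add_one_ne_zero l
      rw [h1, hookDiv_zero_left hb hc, ← neg_neg (detPowCoeff (-1) _ _), ← hookTrace_zero_left,
        map_smul, map_neg]
      have h3 := succ_mul_legWeight z w l
      refine mul_left_cancel₀ h2 ?_
      push_cast at ih ⊢
      rw [smul_eq_mul]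
      linear_combination (-τ * (z - (l + 1)) * (w - (l + 1))) * ih
        - τ ^ (l + 2) * armWeight z w 0 * h3
  | succ k ihk =>
    have hk := succ_mul_armWeight z w k
    induction l with
    | zero =>
      have h2 : (k : ℂ) + 1 ≠ 0 := Nat.cast_add_one_ne_zero k
      have ih := ihk 0
      rw [h1, hookDiv_zero_right hb hc, ← hookTrace_zero_right, map_smul]
      refine mul_left_cancel₀ h2 ?_
      push_cast at ih ⊢
      rw [smul_eq_mul]
      linear_combination (τ * (z + (k + 1)) * (w + (k + 1))) * ih
        - τ ^ (k + 2) * legWeight z w 0 * hk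
    | succ l ihl =>
      have h2 : (k : ℂ) + l + 2 ≠ 0 := by exact_mod_cast Nat.succ_ne_zero (k + l + 1)
      have hl := succ_mul_legWeight z w l
      have ih := ihk (l + 1)
      rw [h1, hookDiv_succ_succ hb hc, map_sub, map_smul, map_smul]
      refine mul_left_cancel₀ h2 ?_
      push_cast at ih ihl ⊢
      rw [smul_eq_mul, smul_eq_mul]
      linear_combination (τ * (z + (k + 1)) * (w + (k + 1))) * ih
        - (τ * (z - (l + 1)) * (w - (l + 1))) * ihl
        - τ ^ (k + l + 3) * legWeight z w (l + 1) * hk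
        - τ ^ (k + l + 3) * armWeight z w (k + 1) * hl

/-- `E tr W^{k+1} = τ^{k+1} (k+1)⁻¹ ∑_{i+j=k} u_i v_j`. -/
theorem apply_trace_pow (hb : ∀ j i i' j', D j i (b i' j') = 0)
    (hc : ∀ j i j' i', D j i (c j' i') = if j' = j ∧ i' = i then 1 else 0)
    (hE : ∀ i j f, E (b i j * f) = τ * E (D j i f)) (hE1 : E 1 = 1) (k : ℕ) :
    ((k : ℂ) + 1) * E (trace ((b * c) ^ (k + 1))) =
      τ ^ (k + 1) * ∑ ij ∈ antidiagonal k, armWeight (Fintype.card n) (Fintype.card m) ij.1 *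
        legWeight (Fintype.card n) (Fintype.card m) ij.2 := by
  rw [← sum_hookTrace, map_sum, mul_sum, mul_sum]
  refine sum_congr rfl fun ij hij => ?_
  have h := apply_hookTrace hb hc hE hE1 ij.1 ij.2
  rw [← mem_antidiagonal.1 hij, ← h]
  push_cast
  rfl

end Expectation

/-! ### The three-term recurrence of the moments. -/

section Recurrence

/-- The moments `∑_{i+j=k} φ(i, j) u_i v_j` of the hook weights. -/
noncomputable def hookSum (z : ℂ) (φ : ℕ → ℕ → ℂ) (k : ℕ) : ℂ :=
  ∑ ij ∈ antidiagonal k, φ ij.1 ij.2 * (armWeight z (z + 1) ij.1 * legWeight z (z + 1) ij.2)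

/-- Summation by shifting: the factor `i` kills the term `i = 0` and lets the arm weight step down
by one. `hookSum_leg` does the same for the leg. -/
theorem hookSum_arm (z : ℂ) (φ : ℕ → ℕ → ℂ) (k : ℕ) :
    hookSum z (fun i j => i * φ i j) (k + 1) =
      hookSum z (fun i j => (z + i + 1) * (z + i + 2) * φ (i + 1) j) k := by
  rw [hookSum, Finset.Nat.sum_antidiagonal_succ, hookSum]
  simp only [Nat.cast_zero, zero_mul, zero_add]
  refine sum_congr rfl fun ij _ => ?_
  have h := succ_mul_armWeight z (z + 1) ij.1
  push_cast
  linear_combination φ (ij.1 + 1) ij.2 * legWeight z (z + 1) ij.2 * h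

theorem hookSum_leg (z : ℂ) (φ : ℕ → ℕ → ℂ) (k : ℕ) :
    hookSum z (fun i j => j * φ i j) (k + 1) =
      hookSum z (fun i j => -((z - j - 1) * (z - j)) * φ i (j + 1)) k := by
  rw [hookSum, Finset.Nat.sum_antidiagonal_succ', hookSum]
  simp only [Nat.cast_zero, zero_mul, zero_add]
  refine sum_congr rfl fun ij _ => ?_
  have h := succ_mul_legWeight z (z + 1) ij.2
  push_cast
  linear_combination φ ij.1 (ij.2 + 1) * armWeight z (z + 1) ij.1 * h

theorem hookSum_eq_of_eq {z : ℂ} {k : ℕ} {φ ψ : ℕ → ℕ → ℂ}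
    (h : ∀ i j, i + j = k → φ i j = ψ i j) : hookSum z φ k = hookSum z ψ k :=
  sum_congr rfl fun ij hij => by rw [h _ _ (mem_antidiagonal.1 hij)]

theorem hookSum_add (z : ℂ) (φ ψ : ℕ → ℕ → ℂ) (k : ℕ) :
    hookSum z (fun i j => φ i j + ψ i j) k = hookSum z φ k + hookSum z ψ k := by
  simp only [hookSum, add_mul, sum_add_distrib]

theorem hookSum_smul (z a : ℂ) (φ : ℕ → ℕ → ℂ) (k : ℕ) :
    hookSum z (fun i j => a * φ i j) k = a * hookSum z φ k := by
  simp only [hookSum, mul_assoc, mul_sum]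

/-- Write `k + 1 = i + j` and shift both parts; the resulting difference factors as `(i + j + 2)(2 z
+ 1 + i - j)`. -/
theorem hookSum_one_succ (z : ℂ) (k : ℕ) :
    ((k : ℂ) + 1) * hookSum z (fun _ _ => 1) (k + 1) = ((k : ℂ) + 2) *
      ((2 * z + 1) * hookSum z (fun _ _ => 1) k + hookSum z (fun i j => (i : ℂ) - j) k) := by
  have h1 := hookSum_arm z (fun _ _ => 1) k
  have h2 := hookSum_leg z (fun _ _ => 1) k
  rw [← hookSum_smul, ← hookSum_smul, ← hookSum_add, ← hookSum_smul]
  have h3 := congrArg₂ (· + ·) h1 h2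
  simp only [← hookSum_add] at h3
  convert h3 using 1
  · refine hookSum_eq_of_eq fun i j h => ?_
    have h : (i : ℂ) + j = k + 1 := by exact_mod_cast h
    linear_combination -h
  · refine hookSum_eq_of_eq fun i j h => ?_
    rw [← h]
    push_cast
    ring

theorem hookSum_sub_succ (z : ℂ) (k : ℕ) :
    ((k : ℂ) + 4) * hookSum z (fun i j => (i : ℂ) - j) (k + 1) = ((k : ℂ) + 2) *
      (((2 * z + 1) ^ 2 - 1 + (k + 2) ^ 2) * hookSum z (fun _ _ => 1) k
        + (2 * z + 1) * hookSum z (fun i j => (i : ℂ) - j) k) := by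
  -- The multiplier `2 k + 5 - (i + j)` of `i - j` equals `k + 4` at level `k + 1`. It is chosen so
  -- that, after the shift, the terms quadratic in `i - j` cancel and the system closes.
  have h1 := hookSum_arm z (fun _ _ => 2 * k + 5) k
  have h2 := hookSum_leg z (fun _ _ => -(2 * k + 5)) k
  have h3 := hookSum_arm z (fun i j => -((i : ℂ) - j)) k
  have h4 := hookSum_leg z (fun i j => -((i : ℂ) - j)) k
  rw [← hookSum_smul, ← hookSum_smul, ← hookSum_smul, ← hookSum_add, ← hookSum_smul]
  have h5 := congrArg₂ (· + ·) (congrArg₂ (· + ·) h1 h2) (congrArg₂ (· + ·) h3 h4)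
  simp only [← hookSum_add] at h5
  convert h5 using 1
  · refine hookSum_eq_of_eq fun i j h => ?_
    have h : (i : ℂ) + j = k + 1 := by exact_mod_cast h
    linear_combination ((i : ℂ) - j) * h
  · refine hookSum_eq_of_eq fun i j h => ?_
    rw [← h]
    push_cast
    ring

/-- The numbers `m_k`, `k ≥ 1`, of which `E tr W^k = τ^k m_k`. -/
noncomputable def wishartMoment (z : ℂ) : ℕ → ℂ
  | 0 => z
  | k + 1 => hookSum z (fun _ _ => 1) k / (k + 1)

theorem wishartMoment_one (z : ℂ) : wishartMoment z 1 = z * (z + 1) := by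
  simp [wishartMoment, hookSum, armWeight, legWeight]

/-- The recurrence of Haagerup and Thorbjørnsen. -/
theorem wishartMoment_recurrence (z : ℂ) (k : ℕ) :
    ((k : ℂ) + 3) * wishartMoment z (k + 2) = (2 * k + 3) * (2 * z + 1) * wishartMoment z (k + 1)
      + k * ((k + 1) ^ 2 - 1) * wishartMoment z k := by
  -- At `k = 0` the last coefficient vanishes, so the separately defined `wishartMoment z 0` does
  -- not matter.
  cases k with
  | zero =>
    have h := hookSum_one_succ z 0
    have h0 : hookSum z (fun i j => (i : ℂ) - j) 0 = 0 := by simp [hookSum]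
    rw [h0] at h
    simp only [wishartMoment]
    push_cast at h ⊢
    linear_combination 3 / 2 * h
  | succ k =>
    have h1 := hookSum_one_succ z k
    have h2 := hookSum_one_succ z (k + 1)
    have h3 := hookSum_sub_succ z k
    simp only [wishartMoment]
    have e1 : (k : ℂ) + 1 ≠ 0 := Nat.cast_add_one_ne_zero k
    have e2 : (k : ℂ) + 2 ≠ 0 := by exact_mod_cast Nat.succ_ne_zero (k + 1)
    have e3 : (k : ℂ) + 3 ≠ 0 := by exact_mod_cast Nat.succ_ne_zero (k + 2)
    push_cast at h1 h2 h3 ⊢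
    have q1 : (k : ℂ) + 1 + 1 = k + 2 := by ring
    have q2 : (k : ℂ) + 2 + 1 = k + 3 := by ring
    have q3 : (k : ℂ) + 1 + 2 = k + 3 := by ring
    rw [q1, q3] at h2
    rw [q1, q2]
    generalize hookSum z (fun _ _ => 1) k = s0 at *
    generalize hookSum z (fun _ _ => 1) (k + 1) = s1 at *
    generalize hookSum z (fun _ _ => 1) (k + 1 + 1) = s2 at *
    generalize hookSum z (fun i j => (i : ℂ) - j) k = d0 at *
    generalize hookSum z (fun i j => (i : ℂ) - j) (k + 1) = d1 at *
    -- The auxiliary sums of arm minus leg are eliminated in favour of three consecutive moments.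
    have d0e : d0 = (k + 1) / (k + 2) * s1 - (2 * z + 1) * s0 := by
      field_simp; linear_combination -h1
    have d1e : d1 = (k + 2) / (k + 3) * s2 - (2 * z + 1) * s1 := by
      field_simp; linear_combination -h2
    rw [d0e, d1e] at h3
    field_simp at h3 ⊢
    linear_combination h3

end Recurrence

end GenLaguerre

namespace GenLaguerre

open MeasureTheory Finset

/-! ### Moments of one complex Gaussian variable. -/

section ComplexGaussian

/-- The moments `∫ z^p (conj z)^q e^{-β |z|²}` of the complex Gaussian. -/
noncomputable def complexMoment (β : ℝ) (p q : ℕ) : ℂ :=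
  ∫ z : ℂ, (Real.exp (-β * ‖z‖ ^ 2) : ℂ) * (z ^ p * (starRingEnd ℂ z) ^ q)

variable {β : ℝ}

theorem integral_norm_pow_mul_exp (hβ : 0 < β) (p : ℕ) :
    ∫ z : ℂ, ‖z‖ ^ p * Real.exp (-β * ‖z‖ ^ 2) =
      Real.pi * β ^ (-((p : ℝ) + 2) / 2) * Real.Gamma (((p : ℝ) + 2) / 2) := by
  have h := Complex.integral_rpow_mul_exp_neg_mul_rpow (p := 2) (q := p) (b := β) (by norm_num)
    (by have := (Nat.cast_nonneg p : (0 : ℝ) ≤ p); linarith) hβ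
  simpa [Real.rpow_natCast] using h

theorem integrable_norm_pow_mul_exp (hβ : 0 < β) (p : ℕ) :
    Integrable fun z : ℂ => ‖z‖ ^ p * Real.exp (-β * ‖z‖ ^ 2) := by
  -- A non-integrable function has integral 0 by convention, so the nonzero closed form gives
  -- integrability.
  refine Integrable.of_integral_ne_zero ?_
  rw [integral_norm_pow_mul_exp hβ]
  have : 0 < Real.Gamma (((p : ℝ) + 2) / 2) := Real.Gamma_pos_of_pos (by positivity)
  positivity

theorem integrable_exp_mul_pow (hβ : 0 < β) (p q : ℕ) :
    Integrable fun z : ℂ => (Real.exp (-β * ‖z‖ ^ 2) : ℂ) * (z ^ p * (starRingEnd ℂ z) ^ q) := by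
  refine (integrable_norm_pow_mul_exp hβ (p + q)).mono' ?_ (Filter.Eventually.of_forall fun z => ?_)
  · apply Continuous.aestronglyMeasurable
    fun_prop
  · simp only [norm_mul, norm_pow, RCLike.norm_conj, Complex.norm_real, Real.norm_eq_abs,
      Real.abs_exp]
    rw [pow_add, mul_comm]

theorem complexMoment_diag (hβ : 0 < β) (p : ℕ) :
    complexMoment β p p = (Real.pi * β⁻¹ ^ (p + 1) * p.factorial : ℝ) := by
  have h := integral_norm_pow_mul_exp hβ (2 * p)
  have e : (((2 * p : ℕ) : ℝ) + 2) / 2 = p + 1 := by push_cast; ring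
  rw [neg_div, e, Real.Gamma_nat_eq_factorial, Real.rpow_neg hβ.le, ← Nat.cast_add_one,
    Real.rpow_natCast, ← inv_pow] at h
  rw [← h, complexMoment, ← integral_complex_ofReal]
  congr 1
  ext z
  rw [← mul_pow, Complex.mul_conj, Complex.normSq_eq_norm_sq]
  push_cast
  ring

/-- Rotation invariance multiplies the moment by `u^p (conj u)^q` for every unit `u`. -/
theorem complexMoment_of_ne {p q : ℕ} (h : p ≠ q) : complexMoment β p q = 0 := by
  have key : ∀ u : ℂ, ‖u‖ = 1 → complexMoment β p q =
      (u ^ p * (starRingEnd ℂ u) ^ q) * complexMoment β p q := by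
    intro u hu
    let e := rotation (⟨u, by simpa [Submonoid.unitSphere] using hu⟩ : Circle)
    have h1 := e.measurePreserving.integral_comp e.toHomeomorph.measurableEmbedding
      (fun z : ℂ => (Real.exp (-β * ‖z‖ ^ 2) : ℂ) * (z ^ p * (starRingEnd ℂ z) ^ q))
    rw [complexMoment, ← integral_const_mul, ← h1]
    congr 1
    ext z
    have h2 : e z = u * z := rfl
    rw [h2, norm_mul, hu, one_mul, map_mul, mul_pow, mul_pow]
    ring
  have hθ : ∃ u : ℂ, ‖u‖ = 1 ∧ u ^ p * (starRingEnd ℂ u) ^ q ≠ 1 := by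
    -- The single rotation by one radian serves all `p ≠ q`, since `π` is irrational.
    refine ⟨Complex.exp ((1 : ℝ) * Complex.I), Complex.norm_exp_ofReal_mul_I 1, ?_⟩
    rw [← Complex.exp_conj, ← Complex.exp_nat_mul, ← Complex.exp_nat_mul, ← Complex.exp_add]
    intro h1
    obtain ⟨k, hk⟩ := Complex.exp_eq_one_iff.1 h1
    simp only [Complex.ofReal_one, one_mul, Complex.conj_I] at hk
    have h2 : (((p : ℝ) - q : ℝ) : ℂ) = ((k * (2 * Real.pi) : ℝ) : ℂ) := by
      have := mul_right_cancel₀ Complex.I_ne_zero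
        (show ((p : ℂ) - q) * Complex.I = (k * (2 * Real.pi)) * Complex.I by
          linear_combination hk)
      exact_mod_cast this
    have h3 : (p : ℝ) - q = k * (2 * Real.pi) := Complex.ofReal_injective h2
    by_cases hk0 : k = 0
    · rw [hk0] at h3
      apply h
      have : (p : ℝ) = q := by simpa [sub_eq_zero] using h3
      exact_mod_cast this
    · refine (irrational_pi.mul_intCast (m := 2 * k) (by omega)).ne_int ((p : ℤ) - q) ?_
      push_cast
      linear_combination -h3
  obtain ⟨u, hu, hne⟩ := hθ
  have h1 := key u hu
  have h2 : (u ^ p * (starRingEnd ℂ u) ^ q - 1) * complexMoment β p q = 0 := by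
    linear_combination -h1
  exact (mul_eq_zero.1 h2).resolve_left (sub_ne_zero.2 hne)

theorem complexMoment_succ (hβ : 0 < β) (p q : ℕ) :
    complexMoment β (p + 1) q = (β : ℂ)⁻¹ * (q * complexMoment β p (q - 1)) := by
  cases q with
  | zero => simp [complexMoment_of_ne (Nat.succ_ne_zero p)]
  | succ q =>
    by_cases h : p = q
    · subst h
      rw [Nat.add_sub_cancel, complexMoment_diag hβ, complexMoment_diag hβ, Nat.factorial_succ]
      push_cast
      ring
    · rw [Nat.add_sub_cancel, complexMoment_of_ne h, complexMoment_of_ne (by omega)]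
      simp

end ComplexGaussian

/-! ### The Gaussian functional on polynomials in the entries and their conjugates. -/

section MatrixGaussian

variable {N M : ℕ}

/-- The Gaussian weight `e^{-β tr B B†}`. -/
noncomputable def gaussWeight (β : ℝ) (b : Fin N → Fin M → ℂ) : ℝ :=
  Real.exp (-β * (Matrix.trace (Matrix.of b * (Matrix.of b).conjTranspose)).re)

theorem gaussWeight_eq_prod (β : ℝ) (b : Fin N → Fin M → ℂ) :
    gaussWeight β b = ∏ i, ∏ j, Real.exp (-β * ‖b i j‖ ^ 2) := by
  simp only [← Real.exp_sum, ← mul_sum, gaussWeight]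
  congr 2
  simp only [Matrix.trace, Matrix.diag_apply, Matrix.mul_apply, Matrix.conjTranspose_apply,
    Matrix.of_apply, Complex.re_sum]
  refine sum_congr rfl fun i _ => sum_congr rfl fun j _ => ?_
  rw [RCLike.star_def, Complex.mul_conj, Complex.ofReal_re, Complex.normSq_eq_norm_sq]

/-- The entries of `B` and their conjugates as independent variables. -/
abbrev EntryVar (N M : ℕ) : Type := (Fin N × Fin M) ⊕ (Fin N × Fin M)

/-- The values of the variables at a matrix. -/
noncomputable def entryVal (b : Fin N → Fin M → ℂ) : EntryVar N M → ℂ :=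
  Sum.elim (fun k => b k.1 k.2) (fun k => starRingEnd ℂ (b k.1 k.2))

theorem gaussWeight_mul_eval_monomial (β : ℝ) (s : EntryVar N M →₀ ℕ) (a : ℂ)
    (b : Fin N → Fin M → ℂ) :
    (gaussWeight β b : ℂ) * MvPolynomial.eval (entryVal b) (MvPolynomial.monomial s a) =
      a * ∏ i, ∏ j, ((Real.exp (-β * ‖b i j‖ ^ 2) : ℂ) *
        (b i j ^ s (Sum.inl (i, j)) * (starRingEnd ℂ (b i j)) ^ s (Sum.inr (i, j)))) := by
  rw [MvPolynomial.eval_monomial, Finsupp.prod_fintype _ _ (fun _ => pow_zero _),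
    Fintype.prod_sum_type, Fintype.prod_prod_type, Fintype.prod_prod_type, gaussWeight_eq_prod]
  simp only [prod_mul_distrib, entryVal, Sum.elim_inl, Sum.elim_inr]
  push_cast
  ring

theorem integrable_gaussWeight_mul_eval {β : ℝ} (hβ : 0 < β) (f : MvPolynomial (EntryVar N M) ℂ) :
    Integrable fun b : Fin N → Fin M → ℂ =>
      (gaussWeight β b : ℂ) * MvPolynomial.eval (entryVal b) f := by
  induction f using MvPolynomial.induction_on' with
  | monomial s a =>
    simp only [gaussWeight_mul_eval_monomial]
    refine Integrable.const_mul ?_ a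
    refine Integrable.fintype_prod_dep (f := fun i (y : Fin M → ℂ) => ∏ j,
      ((Real.exp (-β * ‖y j‖ ^ 2) : ℂ) *
        (y j ^ s (Sum.inl (i, j)) * (starRingEnd ℂ (y j)) ^ s (Sum.inr (i, j))))) fun i => ?_
    exact Integrable.fintype_prod_dep (f := fun j (z : ℂ) => (Real.exp (-β * ‖z‖ ^ 2) : ℂ) *
        (z ^ s (Sum.inl (i, j)) * (starRingEnd ℂ z) ^ s (Sum.inr (i, j))))
        fun j => integrable_exp_mul_pow hβ _ _
  | add p q hp hq =>
    simp only [map_add, mul_add]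
    exact hp.add hq

/-- The unnormalized Gaussian functional on polynomials in the entries and their conjugates. -/
noncomputable def gaussFunctional (N M : ℕ) {β : ℝ} (hβ : 0 < β) :
    MvPolynomial (EntryVar N M) ℂ →ₗ[ℂ] ℂ where
  toFun f := ∫ b : Fin N → Fin M → ℂ, (gaussWeight β b : ℂ) * MvPolynomial.eval (entryVal b) f
  map_add' f g := by
    rw [← integral_add (integrable_gaussWeight_mul_eval hβ f) (integrable_gaussWeight_mul_eval hβ g)]
    simp only [map_add, mul_add]
  map_smul' a f := by
    rw [RingHom.id_apply, smul_eq_mul, ← integral_const_mul]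
    simp only [MvPolynomial.smul_eval]
    congr 1
    ext b
    ring

theorem gaussFunctional_monomial {β : ℝ} (hβ : 0 < β) (s : EntryVar N M →₀ ℕ) (a : ℂ) :
    gaussFunctional N M hβ (MvPolynomial.monomial s a) =
      a * ∏ k : Fin N × Fin M, complexMoment β (s (Sum.inl k)) (s (Sum.inr k)) := by
  change ∫ b : Fin N → Fin M → ℂ, _ = _
  simp only [gaussWeight_mul_eval_monomial]
  rw [integral_const_mul, Fintype.prod_prod_type]
  congr 1
  rw [integral_fintype_prod_volume_eq_prod (fun i (y : Fin M → ℂ) => ∏ j,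
      ((Real.exp (-β * ‖y j‖ ^ 2) : ℂ) *
        (y j ^ s (Sum.inl (i, j)) * (starRingEnd ℂ (y j)) ^ s (Sum.inr (i, j)))))]
  refine prod_congr rfl fun i _ => ?_
  exact integral_fintype_prod_volume_eq_prod (fun j (z : ℂ) => (Real.exp (-β * ‖z‖ ^ 2) : ℂ) *
        (z ^ s (Sum.inl (i, j)) * (starRingEnd ℂ z) ^ s (Sum.inr (i, j))))

/-- Integration by parts against the Gaussian weight. -/
theorem gaussFunctional_X_mul {β : ℝ} (hβ : 0 < β) (k : Fin N × Fin M)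
    (f : MvPolynomial (EntryVar N M) ℂ) :
    gaussFunctional N M hβ (MvPolynomial.X (Sum.inl k) * f) =
      (β : ℂ)⁻¹ * gaussFunctional N M hβ (MvPolynomial.pderiv (Sum.inr k) f) := by
  induction f using MvPolynomial.induction_on' with
  | monomial s a =>
    rw [MvPolynomial.pderiv_monomial, MvPolynomial.X, MvPolynomial.monomial_mul, one_mul,
      gaussFunctional_monomial, gaussFunctional_monomial, ← mul_prod_erase _ _ (mem_univ k),
      ← mul_prod_erase (a := k) univ (fun l => complexMoment β ((s - _) (Sum.inl l)) _) (mem_univ k)]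
    have h1 : ∀ l ∈ univ.erase k,
        complexMoment β ((Finsupp.single (Sum.inl k) 1 + s : EntryVar N M →₀ ℕ) (Sum.inl l))
          ((Finsupp.single (Sum.inl k) 1 + s : EntryVar N M →₀ ℕ) (Sum.inr l)) =
        complexMoment β ((s - Finsupp.single (Sum.inr k) 1 : EntryVar N M →₀ ℕ) (Sum.inl l))
          ((s - Finsupp.single (Sum.inr k) 1 : EntryVar N M →₀ ℕ) (Sum.inr l)) := by
      intro l hl
      have hl' : k ≠ l := (ne_of_mem_erase hl).symm
      simp [hl']
    rw [prod_congr rfl h1]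
    have h2 := complexMoment_succ hβ (s (Sum.inl k)) (s (Sum.inr k))
    simp only [Finsupp.add_apply, Finsupp.tsub_apply, Finsupp.single_eq_same, Finsupp.single_apply,
      reduceCtorEq, if_false, zero_add, Nat.sub_zero]
    rw [add_comm 1, h2]
    ring
  | add p q hp hq => simp only [map_add, mul_add, hp, hq]

end MatrixGaussian

end GenLaguerre

namespace GenLaguerre

open MeasureTheory Finset

/-! ### Exact moments of `B B†`. -/

section Moments

variable {N M : ℕ}

/-- The generic `N × M` matrix. -/
noncomputable def genericMatrix (N M : ℕ) : Matrix (Fin N) (Fin M) (MvPolynomial (EntryVar N M) ℂ) :=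
  Matrix.of fun i j => MvPolynomial.X (Sum.inl (i, j))

/-- The generic adjoint matrix. -/
noncomputable def genericAdjoint (N M : ℕ) :
    Matrix (Fin M) (Fin N) (MvPolynomial (EntryVar N M) ℂ) :=
  Matrix.of fun j i => MvPolynomial.X (Sum.inr (i, j))

theorem eval_trace_generic_pow (b : Fin N → Fin M → ℂ) (p : ℕ) :
    MvPolynomial.eval (entryVal b)
      (Matrix.trace ((genericMatrix N M * genericAdjoint N M) ^ p)) =
    Matrix.trace ((Matrix.of b * (Matrix.of b).conjTranspose) ^ p) := by
  rw [AddMonoidHom.map_trace, ← RingHom.mapMatrix_apply, map_pow, RingHom.mapMatrix_apply,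
    Matrix.map_mul]
  congr 3
  · ext i j; simp [genericMatrix, entryVal]
  · ext i j; simp [genericAdjoint, entryVal]

theorem integral_gaussWeight_pos {β : ℝ} (hβ : 0 < β) :
    0 < ∫ b : Fin N → Fin M → ℂ, gaussWeight β b := by
  have h := gaussFunctional_monomial (N := N) (M := M) hβ 0 1
  have h1 : gaussFunctional N M hβ (MvPolynomial.monomial 0 1) =
      ((∫ b : Fin N → Fin M → ℂ, gaussWeight β b : ℝ) : ℂ) := by
    rw [← integral_complex_ofReal]
    change ∫ b : Fin N → Fin M → ℂ, _ = _
    simp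
  rw [h1] at h
  simp only [Finsupp.coe_zero, Pi.zero_apply, complexMoment_diag hβ, one_mul] at h
  rw [← Complex.ofReal_prod] at h
  rw [Complex.ofReal_injective h]
  positivity

/-- The normalized Gaussian expectation. -/
noncomputable def gaussExpect (N M : ℕ) {β : ℝ} (hβ : 0 < β) :
    MvPolynomial (EntryVar N M) ℂ →ₗ[ℂ] ℂ :=
  (gaussFunctional N M hβ 1)⁻¹ • gaussFunctional N M hβ

theorem gaussFunctional_one {β : ℝ} (hβ : 0 < β) : gaussFunctional N M hβ 1 =
    ∫ b : Fin N → Fin M → ℂ, (gaussWeight β b : ℂ) := by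
  change ∫ b : Fin N → Fin M → ℂ, _ = _
  simp

theorem gaussFunctional_one_ne_zero {β : ℝ} (hβ : 0 < β) : gaussFunctional N M hβ 1 ≠ 0 := by
  rw [gaussFunctional_one, integral_complex_ofReal]
  exact_mod_cast (integral_gaussWeight_pos hβ).ne'

theorem gaussExpect_trace_pow {β : ℝ} (hβ : 0 < β) (k : ℕ) :
    gaussExpect N (N + 1) hβ
      (Matrix.trace ((genericMatrix N (N + 1) * genericAdjoint N (N + 1)) ^ k)) =
      (β : ℂ)⁻¹ ^ k * wishartMoment N k := by
  have h1 : gaussExpect N (N + 1) hβ 1 = 1 := by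
    rw [gaussExpect, LinearMap.smul_apply, smul_eq_mul,
      inv_mul_cancel₀ (gaussFunctional_one_ne_zero hβ)]
  cases k with
  | zero =>
    rw [pow_zero, Matrix.trace_one, ← mul_one (Fintype.card (Fin N) : MvPolynomial _ ℂ),
      ← nsmul_eq_mul, map_nsmul, h1]
    simp [wishartMoment]
  | succ k =>
    have h := apply_trace_pow
      -- Differentiation is in the conjugate entries, which are independent variables of the
      -- polynomial ring.
      (D := fun (j : Fin (N + 1)) (i : Fin N) =>
        (MvPolynomial.pderiv (R := ℂ) (Sum.inr (i, j) : EntryVar N (N + 1))))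
      (b := genericMatrix N (N + 1)) (c := genericAdjoint N (N + 1))
      (E := gaussExpect N (N + 1) hβ) (τ := (β : ℂ)⁻¹) ?_ ?_ ?_ h1 k
    · have hk : (k : ℂ) + 1 ≠ 0 := Nat.cast_add_one_ne_zero k
      refine mul_left_cancel₀ hk (h.trans ?_)
      rw [wishartMoment, hookSum, mul_left_comm, mul_div_cancel₀ _ hk]
      simp
    · intro j i i' j'
      simp [genericMatrix, MvPolynomial.pderiv_X]
    · intro j i j' i'
      simp [genericAdjoint, MvPolynomial.pderiv_X, Pi.single_apply, and_comm]
    · intro i j f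
      simp only [gaussExpect, LinearMap.smul_apply, genericMatrix, Matrix.of_apply,
        gaussFunctional_X_mul, smul_eq_mul]
      ring

theorem average_trace_pow (hN : 0 < N) (p : ℕ) :
    average N (N + 1) (fun B => Matrix.trace ((B * B.conjTranspose) ^ p)) =
      (N : ℂ)⁻¹ ^ p * wishartMoment N p := by
  have hβ : (0 : ℝ) < N := Nat.cast_pos.2 hN
  have h := gaussExpect_trace_pow (N := N) hβ p
  rw [gaussExpect, LinearMap.smul_apply, smul_eq_mul, gaussFunctional_one, mul_comm,
    ← div_eq_mul_inv, Complex.ofReal_natCast] at h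
  rw [← h]
  unfold average
  congr 1
  change _ = ∫ b : Fin N → Fin (N + 1) → ℂ, _
  simp only [eval_trace_generic_pow]
  rfl

end Moments

end GenLaguerre

namespace GenLaguerre

open MeasureTheory Finset

/-! ### Asymptotic expansion of the mean resolvent at infinity. -/

section Resolvent

open scoped ComplexOrder in
/-- The moments and the resolvent of `B B†` in terms of its eigenvalues. -/
theorem exists_eigenvalues {N M : ℕ} (B : Matrix (Fin N) (Fin M) ℂ) :
    ∃ ev : Fin N → ℝ, (∀ i, 0 ≤ ev i) ∧
      (∀ p : ℕ, Matrix.trace ((B * B.conjTranspose) ^ p) = ∑ i, (ev i : ℂ) ^ p) ∧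
      ∀ x : ℂ, (∀ i, x ≠ ev i) →
        Matrix.trace ((Matrix.scalar (Fin N) x - B * B.conjTranspose)⁻¹) =
          ∑ i, (x - ev i)⁻¹ := by
  have hP := Matrix.posSemidef_self_mul_conjTranspose B
  have hA := hP.1
  set U : Matrix (Fin N) (Fin N) ℂ := hA.eigenvectorUnitary.1
  have hs : B * B.conjTranspose =
      U * Matrix.diagonal (fun i => (hA.eigenvalues i : ℂ)) * star U := by
    have := hA.spectral_theorem
    rw [Unitary.conjStarAlgAut_apply] at this
    exact this
  have hUU : U * star U = 1 := Unitary.coe_mul_star_self hA.eigenvectorUnitary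
  have hUU' : star U * U = 1 := Unitary.coe_star_mul_self hA.eigenvectorUnitary
  have hev := hP.eigenvalues_nonneg
  clear_value U
  generalize hA.eigenvalues = ev at hs hev
  have htr : ∀ d : Fin N → ℂ, Matrix.trace (U * Matrix.diagonal d * star U) = ∑ i, d i := by
    intro d
    rw [Matrix.mul_assoc, Matrix.trace_mul_comm, Matrix.mul_assoc, hUU', Matrix.mul_one,
      Matrix.trace_diagonal]
  have hmul : ∀ d e : Fin N → ℂ, (U * Matrix.diagonal d * star U) * (U * Matrix.diagonal e * star U)
      = U * Matrix.diagonal (fun i => d i * e i) * star U := by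
    intro d e
    rw [← Matrix.diagonal_mul_diagonal]
    calc _ = U * Matrix.diagonal d * (star U * U) * Matrix.diagonal e * star U := by
          simp only [Matrix.mul_assoc]
      _ = _ := by rw [hUU', Matrix.mul_one]; simp only [Matrix.mul_assoc]
  have hone : U * Matrix.diagonal (fun _ => (1 : ℂ)) * star U = 1 := by
    rw [Matrix.diagonal_one, Matrix.mul_one, hUU]
  refine ⟨ev, hev, fun p => ?_, fun x hx => ?_⟩
  · have : (B * B.conjTranspose) ^ p =
        U * Matrix.diagonal (fun i => (ev i : ℂ) ^ p) * star U := by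
      induction p with
      | zero => simp only [pow_zero, hone]
      | succ p ih =>
        rw [pow_succ, ih, hs, hmul]
        simp only [pow_succ]
    rw [this, htr]
  · have h1 : Matrix.scalar (Fin N) x = U * Matrix.diagonal (fun _ => x) * star U := by
      have : Matrix.diagonal (fun _ : Fin N => x) = x • (1 : Matrix (Fin N) (Fin N) ℂ) :=
        (Matrix.smul_one_eq_diagonal x).symm
      rw [Matrix.scalar_apply, this, Matrix.mul_smul, Matrix.mul_one, Matrix.smul_mul, hUU]
    have h2 : Matrix.scalar (Fin N) x - B * B.conjTranspose =
        U * Matrix.diagonal (fun i => x - ev i) * star U := by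
      rw [h1, hs, ← Matrix.sub_mul, ← Matrix.mul_sub, Matrix.diagonal_sub]
    have h3 : (Matrix.scalar (Fin N) x - B * B.conjTranspose)⁻¹ =
        U * Matrix.diagonal (fun i => (x - ev i)⁻¹) * star U := by
      refine Matrix.inv_eq_right_inv ?_
      rw [h2, hmul, ← hone]
      congr 3
      ext i
      exact mul_inv_cancel₀ (sub_ne_zero.2 (hx i))
    rw [h3, htr]

theorem inv_sub_sub_sum {x t : ℂ} (hx : x ≠ 0) (hxt : x ≠ t) (P : ℕ) :
    (x - t)⁻¹ - ∑ p ∈ range P, t ^ p / x ^ (p + 1) = t ^ P / (x ^ P * (x - t)) := by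
  have h : x - t ≠ 0 := sub_ne_zero.2 hxt
  induction P with
  | zero => simp
  | succ P ih =>
    rw [sum_range_succ, ← sub_sub, ih]
    field_simp
    ring

/-- Each eigenvalue `t ≥ 0` leaves the remainder `t^P / (x^P (x - t))`, and the sector gives `|x -
t| ≥ δ |x|`. The bound depends on `B` only through a moment, hence can be integrated. -/
theorem norm_trace_resolvent_sub_le {N M : ℕ} (B : Matrix (Fin N) (Fin M) ℂ) {δ : ℝ} (hδ : 0 < δ)
    {x : ℂ} (hx : x ≠ 0) (hxs : x ∈ sector δ) (P : ℕ) :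
    ‖Matrix.trace ((Matrix.scalar (Fin N) x - B * B.conjTranspose)⁻¹)
      - ∑ p ∈ range P, Matrix.trace ((B * B.conjTranspose) ^ p) / x ^ (p + 1)‖ ≤
    ‖Matrix.trace ((B * B.conjTranspose) ^ P)‖ * (δ⁻¹ * ‖1 / x ^ (P + 1)‖) := by
  obtain ⟨ev, hev, hpow, hres⟩ := exists_eigenvalues B
  have hxn : 0 < ‖x‖ := norm_pos_iff.2 hx
  have hdist : ∀ i, δ * ‖x‖ ≤ ‖x - ev i‖ := fun i => hxs _ (hev i)
  have hne : ∀ i, x ≠ ev i := by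
    intro i h
    have h1 := hdist i
    rw [sub_eq_zero.2 h, norm_zero] at h1
    have : 0 < δ * ‖x‖ := by positivity
    linarith
  have h1 : Matrix.trace ((Matrix.scalar (Fin N) x - B * B.conjTranspose)⁻¹)
      - ∑ p ∈ range P, Matrix.trace ((B * B.conjTranspose) ^ p) / x ^ (p + 1) =
      ∑ i, (ev i : ℂ) ^ P / (x ^ P * (x - ev i)) := by
    rw [hres x hne]
    simp only [hpow, sum_div]
    rw [sum_comm, ← sum_sub_distrib]
    exact sum_congr rfl fun i _ => inv_sub_sub_sum hx (hne i) P
  have h2 : ‖Matrix.trace ((B * B.conjTranspose) ^ P)‖ = ∑ i, ev i ^ P := by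
    rw [hpow]
    have : (∑ i, (ev i : ℂ) ^ P) = ((∑ i, ev i ^ P : ℝ) : ℂ) := by push_cast; rfl
    rw [this, Complex.norm_real, Real.norm_of_nonneg (sum_nonneg fun i _ => pow_nonneg (hev i) P)]
  rw [h1, h2, sum_mul]
  refine norm_sum_le_of_le _ fun i _ => ?_
  rw [norm_div, norm_mul, norm_pow, norm_pow, Complex.norm_real, Real.norm_of_nonneg (hev i),
    norm_div, norm_one, norm_pow, div_eq_mul_inv]
  refine mul_le_mul_of_nonneg_left ?_ (pow_nonneg (hev i) P)
  rw [one_div, ← mul_inv, pow_succ]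
  refine inv_anti₀ (by positivity) ?_
  calc δ * (‖x‖ ^ P * ‖x‖) = ‖x‖ ^ P * (δ * ‖x‖) := by ring
    _ ≤ ‖x‖ ^ P * ‖x - ev i‖ := by gcongr; exact hdist i

theorem measurable_trace_resolvent {N M : ℕ} (x : ℂ) :
    Measurable fun b : Fin N → Fin M → ℂ => Matrix.trace
      ((Matrix.scalar (Fin N) x - Matrix.of b * (Matrix.of b).conjTranspose)⁻¹) := by
  have hc : Continuous fun b : Fin N → Fin M → ℂ =>
      Matrix.scalar (Fin N) x - Matrix.of b * (Matrix.of b).conjTranspose := by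
    have h : Continuous fun b : Fin N → Fin M → ℂ => (Matrix.of b : Matrix (Fin N) (Fin M) ℂ) :=
      continuous_id
    exact continuous_const.sub (h.matrix_mul h.matrix_conjTranspose)
  -- By the adjugate formula, measurability survives even where the determinant vanishes.
  simp only [Matrix.inv_def, Ring.inverse_eq_inv', Matrix.trace_smul, smul_eq_mul]
  exact hc.matrix_det.measurable.inv.mul hc.matrix_adjugate.matrix_trace.measurable

theorem integrable_gaussWeight_mul_trace_pow {N M : ℕ} {β : ℝ} (hβ : 0 < β) (p : ℕ) :
    Integrable fun b : Fin N → Fin M → ℂ => (gaussWeight β b : ℂ) *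
      Matrix.trace ((Matrix.of b * (Matrix.of b).conjTranspose) ^ p) := by
  have h := integrable_gaussWeight_mul_eval hβ
    (Matrix.trace ((genericMatrix N M * genericAdjoint N M) ^ p))
  simpa only [eval_trace_generic_pow] using h

theorem continuous_gaussWeight {N M : ℕ} (β : ℝ) :
    Continuous fun b : Fin N → Fin M → ℂ => gaussWeight β b := by
  simp only [gaussWeight_eq_prod]
  fun_prop

/-- The expansion of the one-loop mean at infinity in terms of the moments. -/
theorem W₁_isBigO {N : ℕ} (hN : 0 < N) {δ : ℝ} (hδ : 0 < δ) (P : ℕ) :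
    (fun x : ℂ => W₁ N x - ∑ p ∈ range P,
        ((N : ℂ)⁻¹ ^ (p + 1) * wishartMoment N p) / x ^ (p + 1))
      =O[Bornology.cobounded ℂ ⊓ 𝓟 (sector δ)] fun x : ℂ => 1 / x ^ (P + 1) := by
  have hβ : (0 : ℝ) < N := Nat.cast_pos.2 hN
  set w : (Fin N → Fin (N + 1) → ℂ) → ℂ := fun b => (gaussWeight (N : ℝ) b : ℂ) with hw
  set T : ℕ → (Fin N → Fin (N + 1) → ℂ) → ℂ := fun p b =>
    Matrix.trace ((Matrix.of b * (Matrix.of b).conjTranspose) ^ p) with hT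
  set R : ℂ → (Fin N → Fin (N + 1) → ℂ) → ℂ := fun x b => Matrix.trace
      ((Matrix.scalar (Fin N) x - Matrix.of b * (Matrix.of b).conjTranspose)⁻¹) with hR
  have hT_int : ∀ p, Integrable fun b => w b * T p b := integrable_gaussWeight_mul_trace_pow hβ
  have hw_meas : Measurable w :=
    (Complex.continuous_ofReal.comp (continuous_gaussWeight _)).measurable
  have hbound : ∀ x : ℂ, x ≠ 0 → x ∈ sector δ → ∀ P, ∀ b,
      ‖w b * (R x b - ∑ p ∈ range P, T p b / x ^ (p + 1))‖ ≤
        ‖w b * T P b‖ * (δ⁻¹ * ‖1 / x ^ (P + 1)‖) := by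
    intro x hx hxs P b
    rw [norm_mul, norm_mul, mul_assoc]
    exact mul_le_mul_of_nonneg_left (norm_trace_resolvent_sub_le _ hδ hx hxs P) (norm_nonneg _)
  have hR_int : ∀ x : ℂ, x ≠ 0 → x ∈ sector δ → Integrable fun b => w b * R x b := by
    intro x hx hxs
    refine ((hT_int 0).norm.mul_const (δ⁻¹ * ‖1 / x ^ (0 + 1)‖)).mono'
      (hw_meas.mul (measurable_trace_resolvent x)).aestronglyMeasurable
      (Filter.Eventually.of_forall fun b => ?_)
    -- The remainder bound at `P = 0` dominates the resolvent itself.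
    simpa using hbound x hx hxs 0 b
  have hW : ∀ x : ℂ, W₁ N x = (N : ℂ)⁻¹ * ((∫ b, w b * R x b) / ∫ b, w b) := fun x => rfl
  have hmom : ∀ p, (N : ℂ)⁻¹ ^ (p + 1) * wishartMoment N p =
      (N : ℂ)⁻¹ * ((∫ b, w b * T p b) / ∫ b, w b) := by
    intro p
    rw [pow_succ', mul_assoc, ← average_trace_pow hN]
    rfl
  have hdiff : ∀ x : ℂ, x ≠ 0 → x ∈ sector δ →
      W₁ N x - ∑ p ∈ range P, ((N : ℂ)⁻¹ ^ (p + 1) * wishartMoment N p) / x ^ (p + 1) =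
      ((N : ℂ)⁻¹ / ∫ b, w b) *
        ∫ b, w b * (R x b - ∑ p ∈ range P, T p b / x ^ (p + 1)) := by
    intro x hx hxs
    have h1 : ∫ b, w b * (R x b - ∑ p ∈ range P, T p b / x ^ (p + 1)) =
        (∫ b, w b * R x b) - ∑ p ∈ range P, (∫ b, w b * T p b) / x ^ (p + 1) := by
      simp only [mul_sub, mul_sum, ← mul_div_assoc]
      rw [integral_sub (hR_int x hx hxs)
        (integrable_finsetSum _ fun p _ => (hT_int p).div_const _),
        integral_finsetSum _ fun p _ => (hT_int p).div_const _]
      simp only [integral_div]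
    rw [h1, hW, mul_sub, mul_sum]
    simp only [hmom]
    congr 1
    · ring
    · exact sum_congr rfl fun p _ => by ring
  refine IsBigO.of_bound (‖(N : ℂ)⁻¹ / ∫ b, w b‖ * ((∫ b, ‖w b * T P b‖) * δ⁻¹)) ?_
  have h0 : ∀ᶠ x in Bornology.cobounded ℂ, x ≠ 0 :=
    Bornology.eventually_ne_cobounded 0
  filter_upwards [Filter.mem_inf_of_left h0, Filter.mem_inf_of_right (Filter.mem_principal_self _)]
    with x hx hxs
  rw [hdiff x hx hxs, norm_mul, mul_assoc]
  refine mul_le_mul_of_nonneg_left ?_ (norm_nonneg _)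
  refine (norm_integral_le_of_norm_le ((hT_int P).norm.mul_const _)
    (Filter.Eventually.of_forall (hbound x hx hxs P))).trans (le_of_eq ?_)
  rw [integral_mul_const, mul_assoc]

end Resolvent

end GenLaguerre

namespace GenLaguerre

open Finset Polynomial

/-! ### Polynomials in `1/N`, the genus coefficients, and uniqueness. -/

section Coefficients

/-- The polynomials `r_p` in `1/N` with `N⁻¹ E tr (B B†)^p = r_p(1/N)`. -/
noncomputable def momentPoly : ℕ → ℝ[X]
  | 0 => 1
  | 1 => 1 + X
  | k + 2 => (((k : ℝ) + 3)⁻¹) • ((2 * (k : ℝ) + 3) • ((2 + X) * momentPoly (k + 1))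
      + ((k : ℝ) * ((k + 1) ^ 2 - 1)) • (X ^ 2 * momentPoly k))

theorem momentPoly_recurrence (k : ℕ) : ((k : ℝ) + 3) • momentPoly (k + 2) =
    (2 * (k : ℝ) + 3) • ((2 + X) * momentPoly (k + 1))
      + ((k : ℝ) * ((k + 1) ^ 2 - 1)) • (X ^ 2 * momentPoly k) := by
  have h : (k : ℝ) + 3 ≠ 0 := by positivity
  rw [momentPoly, smul_smul, mul_inv_cancel₀ h, one_smul]

theorem natDegree_momentPoly_le (p : ℕ) : (momentPoly p).natDegree ≤ p := by
  induction p using Nat.strong_induction_on with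
  | _ p ih =>
    match p with
    | 0 => simp [momentPoly]
    | 1 => simp only [momentPoly]; compute_degree
    | k + 2 =>
      rw [momentPoly]
      refine (natDegree_smul_le _ _).trans ((natDegree_add_le _ _).trans (max_le ?_ ?_))
      · refine (natDegree_smul_le _ _).trans (natDegree_mul_le.trans ?_)
        have h1 := ih (k + 1) (by omega)
        have h2 : (2 + X : ℝ[X]).natDegree ≤ 1 := by compute_degree
        omega
      · refine (natDegree_smul_le _ _).trans (natDegree_mul_le.trans ?_)
        have h1 := ih k (by omega)
        have h2 : (X ^ 2 : ℝ[X]).natDegree ≤ 2 := by compute_degree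
        omega

theorem eval_momentPoly {N : ℕ} (hN : 0 < N) (p : ℕ) :
    (((momentPoly p).eval ((N : ℝ)⁻¹) : ℝ) : ℂ) = (N : ℂ)⁻¹ ^ (p + 1) * wishartMoment N p := by
  have hN' : (N : ℂ) ≠ 0 := Nat.cast_ne_zero.2 hN.ne'
  induction p using Nat.strong_induction_on with
  | _ p ih =>
    match p with
    | 0 => simp [momentPoly, wishartMoment, hN']
    | 1 =>
      rw [wishartMoment_one]
      simp only [momentPoly, eval_add, eval_one, eval_X]
      push_cast
      field_simp
    | k + 2 =>
      have h := congrArg (fun q => ((q.eval ((N : ℝ)⁻¹) : ℝ) : ℂ)) (momentPoly_recurrence k)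
      have h1 := ih (k + 1) (by omega)
      have h2 := ih k (by omega)
      have h3 := wishartMoment_recurrence N k
      have h4 : (k : ℂ) + 3 ≠ 0 := by exact_mod_cast Nat.succ_ne_zero (k + 2)
      simp only [eval_smul, eval_add, eval_mul, eval_pow, eval_X, eval_ofNat, smul_eq_mul] at h
      push_cast at h
      rw [h1, h2] at h
      refine mul_left_cancel₀ h4 (h.trans ?_)
      rw [mul_left_comm ((k : ℂ) + 3), h3]
      linear_combination (-2 * (2 * (k : ℂ) + 3) * wishartMoment N (k + 1) * (N : ℂ)⁻¹ ^ (k + 2)) *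
        mul_inv_cancel₀ hN'

/-- The coefficient of `X^j`, `j ∈ ℤ`, of a polynomial. -/
noncomputable def intCoeff (j : ℤ) : ℝ[X] →ₗ[ℝ] ℝ :=
  if 0 ≤ j then lcoeff ℝ j.toNat else 0

theorem intCoeff_natCast (j : ℕ) (q : ℝ[X]) : intCoeff j q = q.coeff j := by
  simp [intCoeff]

theorem intCoeff_of_neg {j : ℤ} (h : j < 0) (q : ℝ[X]) : intCoeff j q = 0 := by
  simp [intCoeff, not_le.2 h]

theorem intCoeff_X_pow_mul (j : ℤ) (k : ℕ) (q : ℝ[X]) :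
    intCoeff j (X ^ k * q) = intCoeff (j - k) q := by
  rcases lt_or_ge j 0 with h | h
  · rw [intCoeff_of_neg h, intCoeff_of_neg (by omega)]
  · lift j to ℕ using h
    rw [intCoeff_natCast, coeff_X_pow_mul']
    split_ifs with hk
    · rw [← Nat.cast_sub hk, intCoeff_natCast]
    · rw [intCoeff_of_neg (by omega)]

theorem intCoeff_X_pow (j : ℤ) (k : ℕ) :
    intCoeff j (X ^ k) = if j = k then 1 else 0 := by
  rcases lt_or_ge j 0 with h | h
  · rw [intCoeff_of_neg h, if_neg (by omega)]
  · lift j to ℕ using h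
    rw [intCoeff_natCast, coeff_X_pow]
    simp

/-- The polynomials `r_n`, extended by zero to negative `n`. -/
noncomputable def intMomentPoly (n : ℤ) : ℝ[X] :=
  if 0 ≤ n then momentPoly n.toNat else 0

theorem intMomentPoly_natCast (n : ℕ) : intMomentPoly n = momentPoly n := by
  simp [intMomentPoly]

theorem intMomentPoly_of_neg {n : ℤ} (h : n < 0) : intMomentPoly n = 0 := by
  simp [intMomentPoly, not_le.2 h]

/-- The generating form of the claim: powers of `X` carry the shifts of `j`, and extension by zero
lets `n` range over all integers. -/
theorem intMomentPoly_recurrence (n : ℤ) :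
    ((n : ℝ) + 1) • ((2 : ℝ) • intMomentPoly n + X ^ 1 * intMomentPoly n)
      - (4 * (2 * (n : ℝ) - 1)) • (intMomentPoly (n - 1) + X ^ 1 * intMomentPoly (n - 1))
      - (((n : ℝ) - 1) * ((n : ℝ) - 2) * ((n : ℝ) - 3)) •
        ((2 : ℝ) • (X ^ 2 * intMomentPoly (n - 2)) + X ^ 3 * intMomentPoly (n - 2))
      - (((n : ℝ) + 1) * ((n : ℝ) - 1)) • (X ^ 2 * intMomentPoly (n - 1))
      + (((n : ℝ) - 1) * ((n : ℝ) - 2) * ((n : ℝ) - 3) ^ 2) • (X ^ 4 * intMomentPoly (n - 3)) =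
    (if n = 0 then (2 : ℝ) • X ^ 0 + X ^ 1 else 0)
      + (if n = 1 then (2 : ℝ) • X ^ 1 + (2 : ℝ) • X ^ 2 else 0) := by
  rcases lt_or_ge n 0 with h | h
  · rw [intMomentPoly_of_neg h, intMomentPoly_of_neg (by omega), intMomentPoly_of_neg (by omega),
      intMomentPoly_of_neg (by omega), if_neg (by omega), if_neg (by omega)]
    simp
  lift n to ℕ using h
  match n with
  | 0 =>
    rw [intMomentPoly_of_neg (n := ((0 : ℕ) : ℤ) - 1) (by omega),
      intMomentPoly_of_neg (n := ((0 : ℕ) : ℤ) - 2) (by omega),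
      intMomentPoly_of_neg (n := ((0 : ℕ) : ℤ) - 3) (by omega), intMomentPoly_natCast]
    simp [momentPoly]
  | 1 =>
    rw [intMomentPoly_of_neg (n := ((1 : ℕ) : ℤ) - 2) (by omega),
      intMomentPoly_of_neg (n := ((1 : ℕ) : ℤ) - 3) (by omega), intMomentPoly_natCast,
      show ((1 : ℕ) : ℤ) - 1 = ((0 : ℕ) : ℤ) by omega, intMomentPoly_natCast]
    rw [if_neg (by omega), if_pos (by omega)]
    simp only [momentPoly, Polynomial.smul_eq_C_mul]
    push_cast
    simp only [map_add, map_mul, map_sub, map_pow, map_one, map_ofNat]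
    ring
  | 2 =>
    have h := momentPoly_recurrence 0
    rw [show ((2 : ℕ) : ℤ) - 1 = ((1 : ℕ) : ℤ) by omega, intMomentPoly_natCast,
      intMomentPoly_natCast, if_neg (by omega), if_neg (by omega)]
    simp only [momentPoly.eq_2, zero_add, Polynomial.smul_eq_C_mul] at h ⊢
    push_cast at h ⊢
    simp only [map_add, map_mul, map_sub, map_pow, map_one, map_ofNat, map_zero] at h ⊢
    -- The multiple of the lower recurrence drops out here, its factor `n - 2` being zero.
    linear_combination (2 + X) * h
  | k + 3 =>
    have h1 := momentPoly_recurrence k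
    have h2 := momentPoly_recurrence (k + 1)
    rw [show ((k + 3 : ℕ) : ℤ) - 1 = ((k + 2 : ℕ) : ℤ) by omega,
      show ((k + 3 : ℕ) : ℤ) - 2 = ((k + 1 : ℕ) : ℤ) by omega,
      show ((k + 3 : ℕ) : ℤ) - 3 = ((k : ℕ) : ℤ) by omega, intMomentPoly_natCast,
      intMomentPoly_natCast, intMomentPoly_natCast, intMomentPoly_natCast, if_neg (by omega),
      if_neg (by omega)]
    simp only [Polynomial.smul_eq_C_mul] at h1 h2 ⊢
    push_cast at h1 h2 ⊢
    simp only [map_add, map_mul, map_sub, map_pow, map_natCast, map_one, map_ofNat] at h1 h2 ⊢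
    linear_combination (2 + X) * h2 - ((k : ℝ[X]) + 1) * X ^ 2 * h1

/-- The coefficients of the expansion in fractional genus. -/
noncomputable def genusCoeff (j n : ℤ) : ℝ :=
  if 0 ≤ n then intCoeff j (intMomentPoly (n + j)) else 0

/-- The cutoff in `genusCoeff` removes nothing when `j` exceeds `n`, because `r_n` has degree at
most `n`. -/
theorem genusCoeff_sub (j n : ℤ) : genusCoeff j (n - j) = intCoeff j (intMomentPoly n) := by
  rw [genusCoeff, sub_add_cancel]
  split_ifs with h
  · rfl
  · rcases lt_or_ge n 0 with hn | hn
    · rw [intMomentPoly_of_neg hn, map_zero]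
    · lift n to ℕ using hn
      lift j to ℕ using (by omega)
      rw [intMomentPoly_natCast, intCoeff_natCast, coeff_eq_zero_of_natDegree_lt]
      have := natDegree_momentPoly_le n
      omega

theorem doubleSeriesCoeff_genusCoeff (N p : ℕ) :
    doubleSeriesCoeff genusCoeff N p = (momentPoly p).eval ((N : ℝ)⁻¹) := by
  rw [eval_eq_sum_range' (Nat.lt_succ_of_le (natDegree_momentPoly_le p)), doubleSeriesCoeff]
  refine sum_congr rfl fun j _ => ?_
  rw [genusCoeff_sub, intMomentPoly_natCast, intCoeff_natCast, inv_pow, div_eq_mul_inv]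

theorem isFractionalGenusExpansion_genusCoeff : IsFractionalGenusExpansion genusCoeff := by
  refine ⟨fun j n h => ?_, fun N hN δ hδ P => ?_⟩
  · rcases h with h | h
    · rw [genusCoeff, intCoeff_of_neg h, ite_self]
    · rw [genusCoeff, if_neg (by omega)]
  · simp only [doubleSeriesCoeff_genusCoeff, eval_momentPoly hN]
    exact W₁_isBigO hN hδ P

/-- At the first index where the expansions could differ, multiplying by `x^{P+1}` leaves a constant
that is `O(1/x)`, hence zero. -/
theorem asymptotic_coeff_unique {l : Filter ℂ} [l.NeBot] (hl : l ≤ Bornology.cobounded ℂ)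
    {f : ℂ → ℂ} {a c : ℕ → ℂ}
    (ha : ∀ P, (fun x => f x - ∑ p ∈ range P, a p / x ^ (p + 1)) =O[l] fun x => 1 / x ^ (P + 1))
    (hc : ∀ P, (fun x => f x - ∑ p ∈ range P, c p / x ^ (p + 1)) =O[l] fun x => 1 / x ^ (P + 1))
    (p : ℕ) : a p = c p := by
  induction p using Nat.strong_induction_on with
  | _ P ih =>
    have hne : ∀ᶠ x in l, x ≠ 0 := hl (Bornology.eventually_ne_cobounded 0)
    have h1 := (hc (P + 1)).sub (ha (P + 1))
    have h2 : (fun x : ℂ => (a P - c P) / x ^ (P + 1)) =O[l] fun x => 1 / x ^ (P + 1 + 1) := by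
      refine h1.congr_left fun x => ?_
      rw [sum_range_succ, sum_range_succ,
        sum_congr rfl fun p hp => by rw [← ih p (mem_range.1 hp)]]
      ring
    have h3 : (fun _ : ℂ => a P - c P) =O[l] fun x => x⁻¹ := by
      refine (h2.mul (isBigO_refl (fun x : ℂ => x ^ (P + 1)) l)).congr' ?_ ?_
      · filter_upwards [hne] with x hx
        field_simp
      · filter_upwards [hne] with x hx
        field_simp
        ring
    have h4 : Filter.Tendsto (fun _ : ℂ => a P - c P) l (nhds 0) :=
      h3.trans_tendsto (Filter.tendsto_inv₀_cobounded.mono_left hl)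
    exact sub_eq_zero.1 (tendsto_nhds_unique tendsto_const_nhds h4)

theorem neBot_cobounded_inf_sector : (Bornology.cobounded ℂ ⊓ 𝓟 (sector 1)).NeBot := by
  -- The negative half-line lies in the sector of aperture constant 1, as `|-s - t| = s + t ≥ s`.
  have h : Filter.Tendsto (fun s : ℝ => -(s : ℂ)) Filter.atTop
      (Bornology.cobounded ℂ ⊓ 𝓟 (sector 1)) := by
    refine Filter.tendsto_inf.2 ⟨?_, Filter.tendsto_principal.2 ?_⟩
    · rw [← tendsto_norm_atTop_iff_cobounded]
      simpa using Filter.tendsto_abs_atTop_atTop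
    · filter_upwards [Filter.eventually_ge_atTop 0] with s hs t ht
      have : -(s : ℂ) - t = ((-(s + t) : ℝ) : ℂ) := by push_cast; ring
      rw [this, norm_neg, Complex.norm_real, Complex.norm_real, norm_neg,
        Real.norm_of_nonneg hs, Real.norm_of_nonneg (by positivity)]
      linarith
  exact h.neBot

theorem IsFractionalGenusExpansion.eq_genusCoeff {C : ℤ → ℤ → ℝ}
    (hC : IsFractionalGenusExpansion C) : C = genusCoeff := by
  have := neBot_cobounded_inf_sector
  have h1 : ∀ N : ℕ, 1 ≤ N → ∀ p, doubleSeriesCoeff C N p = (momentPoly p).eval ((N : ℝ)⁻¹) := by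
    intro N hN p
    rw [← doubleSeriesCoeff_genusCoeff]
    exact Complex.ofReal_injective (asymptotic_coeff_unique inf_le_left
      (hC.2 N hN 1 one_pos) (isFractionalGenusExpansion_genusCoeff.2 N hN 1 one_pos) p)
  have h2 : ∀ p : ℕ, (∑ j ∈ range (p + 1), monomial j (C j ((p : ℤ) - j))) = momentPoly p := by
    intro p
    -- The `C j n` do not depend on `N`, so both sides are fixed polynomials that agree at the
    -- infinitely many points `1/(N + 1)`.
    refine eq_of_infinite_eval_eq _ _ ?_
    refine (Set.infinite_range_of_injective (f := fun N : ℕ => ((N : ℝ) + 1)⁻¹)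
      fun N N' h => ?_).mono ?_
    · have h' := inv_injective h
      exact_mod_cast add_right_cancel h'
    · rintro _ ⟨N, rfl⟩
      have h := h1 (N + 1) (by omega) p
      push_cast at h
      rw [Set.mem_ofPred_eq, ← h, doubleSeriesCoeff, eval_finsetSum]
      refine sum_congr rfl fun j _ => ?_
      rw [eval_monomial, inv_pow, div_eq_mul_inv]
      push_cast
      rfl
  ext j n
  by_cases hjn : j < 0 ∨ n < 0
  · rw [hC.1 j n hjn, isFractionalGenusExpansion_genusCoeff.1 j n hjn]
  · push Not at hjn
    obtain ⟨hj, hn⟩ := hjn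
    lift j to ℕ using hj
    lift n to ℕ using hn
    have h := congrArg (fun q => coeff q j) (h2 (n + j))
    have e : (n : ℤ) = ((n + j : ℕ) : ℤ) - j := by push_cast; ring
    rw [e, genusCoeff_sub, intMomentPoly_natCast, intCoeff_natCast, ← h]
    simp only [finsetSum_coeff, coeff_monomial]
    rw [sum_ite_eq' , if_pos (mem_range.2 (by omega))]

theorem genusCoeff_recurrence (j n : ℤ) :
    ((n : ℝ) + 1) * (2 * genusCoeff j (n - j) + genusCoeff (j - 1) (n - j + 1))
      - 4 * (2 * (n : ℝ) - 1) * (genusCoeff j (n - j - 1) + genusCoeff (j - 1) (n - j))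
      - ((n : ℝ) - 1) * ((n : ℝ) - 2) * ((n : ℝ) - 3) *
          (2 * genusCoeff (j - 2) (n - j) + genusCoeff (j - 3) (n - j + 1))
      - ((n : ℝ) + 1) * ((n : ℝ) - 1) * genusCoeff (j - 2) (n - j + 1)
      + ((n : ℝ) - 1) * ((n : ℝ) - 2) * ((n : ℝ) - 3) ^ 2 * genusCoeff (j - 4) (n - j + 1)
    = 2 * (if j = 0 ∧ n = 0 then 1 else 0) + (if j = 1 ∧ n = 0 then 1 else 0)
      + 2 * (if j = 1 ∧ n = 1 then 1 else 0) + 2 * (if j = 2 ∧ n = 1 then 1 else 0) := by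
  have h := congrArg (intCoeff j) (intMomentPoly_recurrence n)
  simp only [map_add, map_sub, map_smul, intCoeff_X_pow_mul, smul_eq_mul, apply_ite (intCoeff j),
    intCoeff_X_pow, map_zero, ← genusCoeff_sub] at h
  push_cast at h
  rw [show n - (j - 1) = n - j + 1 by ring, show n - 1 - j = n - j - 1 by ring,
    show n - 1 - (j - 1) = n - j by ring, show n - 2 - (j - 2) = n - j by ring,
    show n - 2 - (j - 3) = n - j + 1 by ring, show n - 1 - (j - 2) = n - j + 1 by ring,
    show n - 3 - (j - 4) = n - j + 1 by ring] at h
  rw [h]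
  by_cases h0 : n = 0
  · simp [h0]
  · by_cases h1 : n = 1
    · simp [h1]
    · simp [h0, h1]

end Coefficients

end GenLaguerre

theorem mainTheorem9 :
    (∃! C : ℤ → ℤ → ℝ, GenLaguerre.IsFractionalGenusExpansion C) ∧
    ∀ C : ℤ → ℤ → ℝ, GenLaguerre.IsFractionalGenusExpansion C →
      ∀ j n : ℤ,
        ((n : ℝ) + 1) * (2 * C j (n - j) + C (j - 1) (n - j + 1))
          - 4 * (2 * (n : ℝ) - 1) * (C j (n - j - 1) + C (j - 1) (n - j))
          - ((n : ℝ) - 1) * ((n : ℝ) - 2) * ((n : ℝ) - 3) *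
              (2 * C (j - 2) (n - j) + C (j - 3) (n - j + 1))
          - ((n : ℝ) + 1) * ((n : ℝ) - 1) * C (j - 2) (n - j + 1)
          + ((n : ℝ) - 1) * ((n : ℝ) - 2) * ((n : ℝ) - 3) ^ 2 * C (j - 4) (n - j + 1)
        = 2 * (if j = 0 ∧ n = 0 then 1 else 0) + (if j = 1 ∧ n = 0 then 1 else 0)
          + 2 * (if j = 1 ∧ n = 1 then 1 else 0) + 2 * (if j = 2 ∧ n = 1 then 1 else 0) := by
  refine ⟨⟨GenLaguerre.genusCoeff, GenLaguerre.isFractionalGenusExpansion_genusCoeff,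
    fun C hC => hC.eq_genusCoeff⟩, fun C hC j n => ?_⟩
  rw [hC.eq_genusCoeff]
  exact GenLaguerre.genusCoeff_recurrence j n
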